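/- Consider 3-CNF formulas over the variables $x_1,\dots,x_n$. A clause is a disjunction of three literals over three distinct variables, so there are $M=8\binom n3$ possible clauses. For $p\in[0,1]$, let $\mathcal P^{\rm sat}_{n,p}$ be the distribution of the random satisfiable formula $F^*$ generated as follows: order all $M$ clauses by a uniformly random permutation, start from the empty formula, scan the clauses in this order, and for each clause toss an independent coin with success probability $p$; the clause is included if its coin toss succeeds and the formula remains satisfiable after its addition. The Majority Vote assignment $\mathrm{MAJ}$ over a formula $F$ sets a variable $x$ to TRUE if the number of clauses of $F$ that contain the literal $x$ is strictly larger than the number of clauses of $F$ that contain the literal $\bar x$, and to FALSE otherwise. **Proposition.** There are absolute constants $c>0$ and $d>0$ such that the following holds. Let $p=p(n)\in[0,1]$ satisfy $n^2p\ge d$ for all sufficiently large $n$, put $m=pM$, and let $F^*$ be distributed according to $\mathcal P^{\rm sat}_{n,p}$. Then with probability $1-o(m^{-1/2})$, as $n\to\infty$, every satisfying assignment of $F^*$ differs from the assignment $\mathrm{MAJ}$ over $F^*$ on at most $e^{-c\,n^2p}\,n$ variables. -/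

import Mathlib

open scoped ENNReal

namespace RandomSat

/-- A literal over the variables `x_0, …, x_{n-1}`: `(x, true)` is the positive literal `x`,
`(x, false)` is the negated literal. -/
abbrev Literal (n : ℕ) := Fin n × Bool

/-- A 3-clause: a set of three literals over three distinct variables. There are
`8 * n.choose 3` of them. -/
abbrev Clause (n : ℕ) :=
  {C : Finset (Literal n) // C.card = 3 ∧ (C.image Prod.fst).card = 3}

/-- A 3-CNF formula, as a set of clauses. -/
abbrev Formula (n : ℕ) := Finset (Clause n)

/-- A truth assignment. -/
abbrev Assignment (n : ℕ) := Fin n → Bool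

/-- The assignment `ψ` satisfies `F`: every clause of `F` contains a literal that is true
under `ψ`. -/
def Satisfies {n : ℕ} (ψ : Assignment n) (F : Formula n) : Prop :=
  ∀ C ∈ F, ∃ l ∈ C.1, ψ l.1 = l.2

/-- The formula `F` has a satisfying assignment. -/
def Satisfiable {n : ℕ} (F : Formula n) : Prop :=
  ∃ ψ : Assignment n, Satisfies ψ F

/-- The orderings (permutations) of all 3-clauses over `n` variables. -/
abbrev Ordering (n : ℕ) := Fin (Fintype.card (Clause n)) ≃ Clause n

instance (n : ℕ) : Nonempty (Ordering n) := ⟨(Fintype.equivFin (Clause n)).symm⟩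

open Classical in
/-- Scan the clauses in the order `σ`, starting from the empty formula, and include the current
clause if its coin toss was successful and the formula stays satisfiable. -/
noncomputable def process {n : ℕ} (σ : Ordering n) (coin : Clause n → Bool) : Formula n :=
  (List.ofFn σ).foldl
    (fun F C => if coin C = true ∧ Satisfiable (insert C F) then insert C F else F) ∅

/-- Independent coin tosses, one for each clause, each successful with probability `p`. -/
noncomputable def coins (n : ℕ) (p : unitInterval) : PMF (Clause n → Bool) :=
  PMF.ofFintype
    (fun coin => ∏ C, if coin C = true then ENNReal.ofReal p else ENNReal.ofReal (1 - p))
    (by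
      have h := Fintype.prod_sum (R := ℝ≥0∞) (ι := Clause n) (κ := fun _ => Bool)
        (fun _ b => if b = true then ENNReal.ofReal p else ENNReal.ofReal (1 - p))
      rw [← h]
      apply Finset.prod_eq_one
      intro C _
      simp only [Fintype.sum_bool, if_true, Bool.false_eq_true, if_false]
      rw [← ENNReal.ofReal_add p.2.1 (by linarith [p.2.2])]
      simp)

/-- The distribution `P^sat_{n,p}` on satisfiable 3-CNF formulas: the outcome of the process for a
uniformly random ordering of the clauses and independent `p`-coins. -/
noncomputable def Psat (n : ℕ) (p : unitInterval) : PMF (Formula n) :=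
  (PMF.uniformOfFintype (Ordering n)).bind fun σ => (coins n p).map (process σ)

/-- The set of clauses of `F` in which the literal `l` appears. -/
def occurrences {n : ℕ} (F : Formula n) (l : Literal n) : Finset (Clause n) :=
  F.filter fun C => l ∈ C.1

/-- The Majority Vote assignment over `F`: `x` is set to true iff `x` appears positively in more
clauses than negatively. -/
def maj {n : ℕ} (F : Formula n) : Assignment n := fun x =>
  decide ((occurrences F (x, false)).card < (occurrences F (x, true)).card)

/-- Every satisfying assignment of `F` differs from the Majority Vote over `F` on at most `r`
variables. -/
def MajClose {n : ℕ} (F : Formula n) (r : ℝ) : Prop :=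
  ∀ ψ : Assignment n, Satisfies ψ F → (hammingDist ψ (maj F) : ℝ) ≤ r

/-- The expected number `m = p * M` of successful coin tosses, `M = 8 * n.choose 3` being the
number of all 3-clauses. -/
noncomputable def expectedTosses (n : ℕ) (p : unitInterval) : ℝ :=
  p * (8 * n.choose 3 : ℕ)

/-- `whp`, for formulas `F` drawn from `P^sat_{n,p(n)}`: the property `A n` holds with probability
`1 - o(m^{-1/2})`, where `m = p(n) * M`. -/
def Whp (p : ℕ → unitInterval) (A : (n : ℕ) → Formula n → Prop) : Prop :=
  (fun n => ((Psat n (p n)).toOuterMeasure {F | ¬ A n F}).toReal)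
    =o[Filter.atTop] fun n => (Real.sqrt (expectedTosses n (p n)))⁻¹

end RandomSat


/-!
Let `λ = n² p`. The tosses of a `p`-coin can be made in three independent rounds, two with
probability `p / 10 ^ 4` and a third one with the remaining probability, and the clauses can be
scanned round by round: given the coins, listing the successful clauses in another order only
permutes the orderings.

* After the first round, a clause that was tossed successfully and is true under some satisfying
  assignment has been accepted, so a satisfying assignment that disagrees with a given one on a set
  `D` makes certain clauses impossible among the successful ones. For `#D ≥ n / 20` these are about
  `n³` clauses, and a union bound over the `4 ^ n` pairs of an assignment and a set shows that all
  satisfying assignments agree on all but `n / 20` variables. A set of intermediate size is excluded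
  by the clauses with exactly one variable in `D`; since the sets that satisfy this condition are
  closed under unions, the union of the small ones is small again.
* In the second round, a clause that is false on a variable `x` and two frozen variables freezes
  `x`, whether it is accepted or not. All but `exp (-cλ) n` variables are hit by such a clause.
* In the third round, a clause that is false on three frozen variables is never accepted, which
  biases the votes of every frozen variable towards its frozen value by order `λ`. The votes of the
  first two rounds are too few to compensate for this, except at `exp (-cλ) n` variables.
-/

namespace RandomSat

open Finset MeasureTheory ProbabilityTheory Real

theorem choose_le_exp_mul_div_pow (n : ℕ) {s : ℕ} (hs : 0 < s) :
    (n.choose s : ℝ) ≤ (exp 1 * n / s) ^ s := by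
  have hfactorial : (s : ℝ) ^ s ≤ exp 1 ^ s * s.factorial := by
    rw [← exp_nat_mul, mul_one, ← div_le_iff₀ (by positivity)]
    exact pow_div_factorial_le_exp _ (by positivity) s
  calc (n.choose s : ℝ) ≤ n ^ s / s.factorial := Nat.choose_le_pow_div s n
    _ ≤ (exp 1 * n) ^ s / s ^ s := by
        rw [div_le_div_iff₀ (by positivity) (by positivity), mul_pow]
        calc (n : ℝ) ^ s * s ^ s ≤ n ^ s * (exp 1 ^ s * s.factorial) := by gcongr
          _ = exp 1 ^ s * n ^ s * s.factorial := by ring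
    _ = (exp 1 * n / s) ^ s := (div_pow _ _ _).symm

theorem choose_le_exp_two_mul {n s : ℕ} (hs : 0 < s) {y : ℝ} (hy : 3 ≤ y)
    (hn : n ≤ 4 * s * exp y) : n.choose s ≤ exp (2 * y * s) := by
  have hfour : (4 : ℝ) ≤ exp 2 := by
    linarith [quadratic_le_exp_of_nonneg (x := 2) (by norm_num)]
  have hbase : exp 1 * n / s ≤ exp (2 * y) := by
    rw [div_le_iff₀ (by positivity)]
    calc exp 1 * n ≤ exp 1 * (exp 2 * s * exp y) := by gcongr; exact hn.trans (by gcongr)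
      _ = exp (1 + 2 + y) * s := by rw [exp_add, exp_add]; ring
      _ ≤ exp (2 * y) * s := by gcongr; linarith
  calc (n.choose s : ℝ) ≤ (exp 1 * n / s) ^ s := choose_le_exp_mul_div_pow n hs
    _ ≤ exp (2 * y) ^ s := by gcongr
    _ = exp (2 * y * s) := by rw [← exp_nat_mul, mul_comm]

theorem choose_mul_exp_le {n s : ℕ} (hs : 0 < s) {y : ℝ} (hy : 3 ≤ y)
    (hn : n ≤ 4 * s * exp y) : n.choose s * exp (-(4 * y * s)) ≤ 4 / (n * y) := by
  rcases n.eq_zero_or_pos with rfl | hn0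
  · simp [Nat.choose_eq_zero_of_lt hs]
  have hs1 : (1 : ℝ) ≤ s := mod_cast hs
  have hsexp : s ≤ exp (y * (s - 1)) := by nlinarith [add_one_le_exp (y * (s - 1))]
  have hnexp : n / 4 ≤ exp (y * s) := by
    calc (n : ℝ) / 4 ≤ s * exp y := by linarith
      _ ≤ exp (y * (s - 1)) * exp y := by gcongr
      _ = exp (y * s) := by rw [← exp_add]; ring_nf
  have hyexp : y ≤ exp (y * s) := by nlinarith [add_one_le_exp (y * s)]
  calc n.choose s * exp (-(4 * y * s)) ≤ exp (2 * y * s) * exp (-(4 * y * s)) := by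
        gcongr; exact choose_le_exp_two_mul hs hy hn
    _ = 1 / (exp (y * s) * exp (y * s)) := by
        rw [← exp_add, ← exp_add, one_div, ← exp_neg]; ring_nf
    _ ≤ 1 / (n / 4 * y) := by gcongr
    _ = 4 / (n * y) := by field_simp

theorem measureReal_prod_le_add {Ω Ω' : Type*} [MeasurableSpace Ω] [MeasurableSpace Ω']
    (μ : Measure Ω) [IsProbabilityMeasure μ] (ν : Measure Ω') [IsProbabilityMeasure ν] {A : Set Ω}
    (hA : MeasurableSet A) {B : Set (Ω × Ω')} (hB : MeasurableSet B) {δ : ℝ} (hδ : 0 ≤ δ)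
    (h : ∀ a ∉ A, ν.real (Prod.mk a ⁻¹' B) ≤ δ) :
    (μ.prod ν).real B ≤ μ.real A + δ := by
  have hsection (a : Ω) : ν (Prod.mk a ⁻¹' (B \ Prod.fst ⁻¹' A)) ≤ ENNReal.ofReal δ := by
    by_cases ha : a ∈ A
    · simp [Set.preimage, ha]
    · exact (measure_mono (Set.preimage_mono Set.sdiff_subset)).trans <|
        (ENNReal.le_ofReal_iff_toReal_le (measure_ne_top _ _) hδ).2 (h a ha)
  have hrest : (μ.prod ν).real (B \ Prod.fst ⁻¹' A) ≤ δ := by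
    refine ENNReal.toReal_le_of_le_ofReal hδ ?_
    rw [Measure.prod_apply (hB.diff (measurable_fst hA))]
    exact (lintegral_mono hsection).trans (by simp)
  calc (μ.prod ν).real B
      ≤ (μ.prod ν).real (Prod.fst ⁻¹' A ∪ B \ Prod.fst ⁻¹' A) :=
        measureReal_mono (by rw [Set.union_sdiff_self]; exact Set.subset_union_right)
    _ ≤ (μ.prod ν).real (Prod.fst ⁻¹' A) + δ := (measureReal_union_le _ _).trans (by gcongr)
    _ = μ.real A + δ := by
        rw [measurePreserving_fst.measureReal_preimage hA.nullMeasurableSet]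

theorem measureReal_le_card_le {Ω V : Type*} [MeasurableSpace Ω] [Fintype V]
    (μ : Measure Ω) [IsFiniteMeasure μ] (fail : Ω → Finset V) (s : ℕ) {δ : ℝ}
    (hfail : ∀ X : Finset V, #X = s → μ.real {ω | X ⊆ fail ω} ≤ δ) :
    μ.real {ω | s ≤ #(fail ω)} ≤ (Fintype.card V).choose s * δ := by
  calc μ.real {ω | s ≤ #(fail ω)}
      ≤ μ.real (⋃ X ∈ powersetCard s univ, {ω | X ⊆ fail ω}) := by
        refine measureReal_mono (fun ω hω ↦ ?_) (measure_ne_top _ _)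
        obtain ⟨X, hX, hXs⟩ := exists_subset_card_eq hω
        simpa using ⟨X, hXs, hX⟩
    _ ≤ ∑ X ∈ powersetCard s univ, μ.real {ω | X ⊆ fail ω} := measureReal_biUnion_finset_le _ _
    _ ≤ #(powersetCard s (univ : Finset V)) • δ :=
        sum_le_card_nsmul _ _ _ fun X hX ↦ hfail X (mem_powersetCard.1 hX).2
    _ = (Fintype.card V).choose s * δ := by rw [card_powersetCard, card_univ, nsmul_eq_mul]

theorem measureReal_lt_card_le {Ω V : Type*} [MeasurableSpace Ω] [Fintype V]
    (μ : Measure Ω) [IsFiniteMeasure μ] (fail : Ω → Finset V) {y : ℝ} (hy : 3 ≤ y)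
    (hfail : ∀ X : Finset V, μ.real {ω | X ⊆ fail ω} ≤ exp (-(4 * y * #X))) :
    μ.real {ω | exp (-y) * Fintype.card V / 4 < #(fail ω)} ≤ 4 / (Fintype.card V * y) := by
  set s := ⌊exp (-y) * Fintype.card V / 4⌋₊ + 1
  have hs : Fintype.card V ≤ 4 * s * exp y := by
    have hfloor : exp (-y) * Fintype.card V / 4 < s := mod_cast Nat.lt_floor_add_one _
    calc (Fintype.card V : ℝ) = 4 * (exp (-y) * Fintype.card V / 4) * exp y := by
          rw [exp_neg]; field_simp
      _ ≤ 4 * s * exp y := by gcongr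
  calc μ.real {ω | exp (-y) * Fintype.card V / 4 < #(fail ω)} = μ.real {ω | s ≤ #(fail ω)} := by
        have hthreshold : 0 ≤ exp (-y) * Fintype.card V / 4 := by positivity
        simp only [s, Nat.add_one_le_iff, Nat.floor_lt hthreshold]
    _ ≤ (Fintype.card V).choose s * exp (-(4 * y * s)) :=
        measureReal_le_card_le μ fail s fun X hX ↦ hX ▸ hfail X
    _ ≤ 4 / (Fintype.card V * y) := choose_mul_exp_le (Nat.succ_pos _) hy hs

section Coins

variable {ι : Type*} [Fintype ι]

/-- Independent tosses of a `q`-coin for every element of `ι`. -/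
noncomputable def coinMeasure (ι : Type*) [Fintype ι] (q : unitInterval) : Measure (ι → Bool) :=
  Measure.pi fun _ ↦ bernoulliMeasure true false q

instance (q : unitInterval) : IsProbabilityMeasure (coinMeasure ι q) := by
  unfold coinMeasure; infer_instance

/-- The set of successful tosses. -/
def heads (b : ι → Bool) : Finset ι := {i | b i = true}

theorem mem_heads {b : ι → Bool} {i : ι} : i ∈ heads b ↔ b i = true := by simp [heads]

theorem measureReal_sum_heads_ge_le (q : unitInterval) (w : ι → ℝ) (r : ℝ) :
    (coinMeasure ι q).real {b | r ≤ ∑ i ∈ heads b, w i}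
      ≤ exp (q * ∑ i, (exp (w i) - 1) - r) := by
  have hmgf : mgf (fun b ↦ ∑ i ∈ heads b, w i) (coinMeasure ι q) 1
      = ∏ i, (1 + q * (exp (w i) - 1)) := by
    have hexp (b : ι → Bool) :
        exp (1 * ∑ i ∈ heads b, w i) = ∏ i, if b i = true then exp (w i) else 1 := by
      rw [one_mul, exp_sum, heads, prod_filter]
    simp only [mgf, hexp, coinMeasure]
    rw [integral_fintype_prod_eq_prod fun i (c : Bool) ↦ if c = true then exp (w i) else 1]
    refine prod_congr rfl fun i _ ↦ ?_
    simp only [integral_bernoulliMeasure, if_true, Bool.false_eq_true, if_false, smul_eq_mul]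
    ring
  have hmarkov := measure_ge_le_exp_mul_mgf (μ := coinMeasure ι q)
    (X := fun b ↦ ∑ i ∈ heads b, w i) r zero_le_one .of_finite
  refine hmarkov.trans ?_
  rw [hmgf, sub_eq_neg_add, exp_add, neg_one_mul, mul_sum, exp_sum]
  refine mul_le_mul_of_nonneg_left (prod_le_prod (fun i _ ↦ ?_) fun i _ ↦ ?_) (exp_pos _).le
  · nlinarith [q.2.1, q.2.2, exp_pos (w i)]
  · linarith [add_one_le_exp (q * (exp (w i) - 1) : ℝ)]

theorem measureReal_disjoint_heads_le (q : unitInterval) (T : Finset ι) :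
    (coinMeasure ι q).real {b | Disjoint (heads b) T} ≤ exp (-(q * #T)) := by
  classical
  have hpi : {b : ι → Bool | Disjoint (heads b) T}
      = Set.univ.pi fun i ↦ if i ∈ T then {false} else Set.univ := by
    ext b
    simp only [Set.mem_ofPred_eq, Set.mem_univ_pi, disjoint_right, mem_heads, Bool.not_eq_true]
    exact forall_congr' fun i ↦ by split_ifs with hi <;> simp [hi]
  have hfactor (i : ι) : (bernoulliMeasure true false q).real
      (if i ∈ T then {false} else Set.univ) = if i ∈ T then 1 - (q : ℝ) else 1 := by
    split_ifs <;> simp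
  rw [hpi, coinMeasure, measureReal_def, Measure.pi_pi, ENNReal.toReal_prod]
  simp only [← measureReal_def, hfactor]
  rw [prod_ite_mem, univ_inter, prod_const, neg_mul_eq_mul_neg, mul_comm, neg_mul_comm,
    exp_nat_mul]
  exact pow_le_pow_left₀ (by linarith [q.2.2]) (one_sub_le_exp_neg _) _

theorem measureReal_exists_disjoint_heads_le (q : unitInterval) {κ : Type*} (J : Finset κ)
    (T : κ → Finset ι) {t : ℕ} (hT : ∀ j ∈ J, t ≤ #(T j)) :
    (coinMeasure ι q).real {b | ∃ j ∈ J, Disjoint (heads b) (T j)} ≤ #J * exp (-(q * t)) := by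
  have hunion : {b : ι → Bool | ∃ j ∈ J, Disjoint (heads b) (T j)}
      = ⋃ j ∈ J, {b | Disjoint (heads b) (T j)} := by ext; simp
  rw [hunion, ← nsmul_eq_mul]
  refine (measureReal_biUnion_finset_le _ _).trans (sum_le_card_nsmul _ _ _ fun j hj ↦ ?_)
  refine (measureReal_disjoint_heads_le q (T j)).trans (exp_le_exp.2 ?_)
  have := q.2.1
  gcongr
  exact hT j hj

theorem sum_exp_mul_sub_one_le (w : ι → ℝ) {θ k : ℝ} (hθ : 0 ≤ θ) (hθk : θ * k ≤ 1)
    (hw : ∀ i, |w i| ≤ k) :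
    ∑ i, (exp (θ * w i) - 1) ≤ θ * ∑ i, w i + k * θ ^ 2 * ∑ i, |w i| := by
  rw [mul_sum, mul_sum, ← sum_add_distrib]
  refine sum_le_sum fun i _ ↦ ?_
  have hsmall : |θ * w i| ≤ 1 := by
    rw [abs_mul, abs_of_nonneg hθ]
    exact (mul_le_mul_of_nonneg_left (hw i) hθ).trans hθk
  have hsq : (θ * w i) ^ 2 ≤ k * θ ^ 2 * |w i| := by
    calc (θ * w i) ^ 2 = θ ^ 2 * |w i| * |w i| := by rw [mul_assoc, ← sq, sq_abs]; ring
      _ ≤ θ ^ 2 * |w i| * k := by gcongr; exact hw i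
      _ = k * θ ^ 2 * |w i| := by ring
  linarith [(le_abs_self _).trans (abs_exp_sub_one_sub_id_le hsmall)]

theorem measureReal_forall_mem_sum_heads_ge_le (q : unitInterval) {V : Type*} [Fintype V]
    (v : V → ι → ℝ) {M k K θ : ℝ} (hM : ∀ x, ∑ i, v x i ≤ M) (hk : ∀ i, ∑ x, |v x i| ≤ k)
    (hK : ∀ x, ∑ i, |v x i| ≤ K) (hk0 : 0 ≤ k) (hθ : 0 ≤ θ) (hθk : θ * k ≤ 1) (r : ℝ)
    (X : Finset V) :
    (coinMeasure ι q).real {b | ∀ x ∈ X, r ≤ ∑ i ∈ heads b, v x i}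
      ≤ exp (-((θ * r - q * (θ * M + k * θ ^ 2 * K)) * #X)) := by
  set w : ι → ℝ := fun i ↦ ∑ x ∈ X, v x i
  have habs (i : ι) : |w i| ≤ ∑ x ∈ X, |v x i| := abs_sum_le_sum_abs _ _
  have hw (i : ι) : |w i| ≤ k :=
    (habs i).trans <| (sum_le_univ_sum_of_nonneg fun x ↦ abs_nonneg _).trans (hk i)
  have hmean : ∑ i, w i ≤ #X * M := by
    rw [sum_comm, ← nsmul_eq_mul]
    exact sum_le_card_nsmul _ _ _ fun x _ ↦ hM x
  have hvar : ∑ i, |w i| ≤ #X * K := by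
    refine (sum_le_sum fun i _ ↦ habs i).trans ?_
    rw [sum_comm, ← nsmul_eq_mul]
    exact sum_le_card_nsmul _ _ _ fun x _ ↦ hK x
  have hexp : ∑ i, (exp (θ * w i) - 1) ≤ (θ * M + k * θ ^ 2 * K) * #X := by
    calc _ ≤ θ * ∑ i, w i + k * θ ^ 2 * ∑ i, |w i| := sum_exp_mul_sub_one_le w hθ hθk hw
      _ ≤ θ * (#X * M) + k * θ ^ 2 * (#X * K) := by gcongr
      _ = (θ * M + k * θ ^ 2 * K) * #X := by ring
  have hsub : {b : ι → Bool | ∀ x ∈ X, r ≤ ∑ i ∈ heads b, v x i}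
      ⊆ {b | θ * r * #X ≤ ∑ i ∈ heads b, θ * w i} := by
    intro b hb
    rw [Set.mem_ofPred_eq, ← mul_sum, sum_comm, mul_assoc, mul_comm r, ← nsmul_eq_mul]
    exact mul_le_mul_of_nonneg_left (card_nsmul_le_sum _ _ _ hb) hθ
  refine (measureReal_mono hsub).trans ((measureReal_sum_heads_ge_le q _ _).trans ?_)
  have := mul_le_mul_of_nonneg_left hexp q.2.1
  exact exp_le_exp.2 (by linarith)

/-- The success probability of the disjunction of independent tosses of an `s`-coin and a
`t`-coin. -/
def coinOr (s t : unitInterval) : unitInterval :=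
  unitInterval.symm (unitInterval.symm s * unitInterval.symm t)

theorem coe_coinOr (s t : unitInterval) : (coinOr s t : ℝ) = 1 - (1 - s) * (1 - t) := rfl

theorem measurePreserving_bernoulliMeasure_or (s t : unitInterval) :
    MeasurePreserving (fun c : Bool × Bool ↦ c.1 || c.2)
      ((bernoulliMeasure true false s).prod (bernoulliMeasure true false t))
      (bernoulliMeasure true false (coinOr s t)) := by
  have hfalse : (fun c : Bool × Bool ↦ c.1 || c.2) ⁻¹' {false} = {false} ×ˢ {false} := by
    ext c; simp [Prod.ext_iff]
  have htrue : (fun c : Bool × Bool ↦ c.1 || c.2) ⁻¹' {true} = ({false} ×ˢ {false})ᶜ := by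
    rw [← hfalse, ← Set.preimage_compl, Bool.compl_singleton]; rfl
  refine ⟨.of_discrete, Measure.ext_of_singleton fun c ↦ ?_⟩
  rw [Measure.map_apply .of_discrete .of_discrete, ← measureReal_eq_measureReal_iff]
  cases c
  · rw [hfalse, measureReal_prod_prod]
    simp [coe_coinOr]
  · rw [htrue, probReal_compl_eq_one_sub .of_discrete, measureReal_prod_prod]
    simp [coe_coinOr]

theorem measurePreserving_coinMeasure_or (s t : unitInterval) :
    MeasurePreserving (fun (ω : (ι → Bool) × (ι → Bool)) i ↦ ω.1 i || ω.2 i)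
      ((coinMeasure ι s).prod (coinMeasure ι t)) (coinMeasure ι (coinOr s t)) :=
  (measurePreserving_pi _ _ fun _ ↦ measurePreserving_bernoulliMeasure_or s t).comp
    (measurePreserving_arrowProdEquivProdArrow Bool Bool ι _ _).symm

theorem measurePreserving_coinMeasure_comp_equiv {κ : Type*} [Fintype κ] (q : unitInterval)
    (e : ι ≃ κ) :
    MeasurePreserving (fun b : κ → Bool ↦ b ∘ e) (coinMeasure κ q) (coinMeasure ι q) :=
  (measurePreserving_piCongrLeft (fun _ ↦ bernoulliMeasure true false q) e).symm

theorem exists_coinOr_coinOr_eq {p q : unitInterval} (h : (q : ℝ) ≤ p / 4) :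
    ∃ r : unitInterval, coinOr q (coinOr q r) = p ∧ (p / 2 : ℝ) ≤ r := by
  have hp := p.2
  have hq := q.2.1
  have hqpos : 0 < (1 - (q : ℝ)) ^ 2 := pow_pos (by linarith [hp.2]) 2
  have hr : (1 - p : ℝ) / (1 - q) ^ 2 ≤ 1 - p / 2 := by
    rw [div_le_iff₀ hqpos]
    nlinarith [sq_nonneg (p : ℝ), hp.1, hp.2, sq_nonneg (q : ℝ)]
  have hr0 : 0 ≤ (1 - p : ℝ) / (1 - q) ^ 2 := div_nonneg (by linarith [hp.2]) hqpos.le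
  refine ⟨⟨1 - (1 - p) / (1 - q) ^ 2, by linarith [hp.1], by linarith⟩, Subtype.ext ?_, ?_⟩
  · simp only [coe_coinOr]
    linarith [mul_div_cancel₀ (1 - p : ℝ) hqpos.ne']
  · change (p / 2 : ℝ) ≤ 1 - (1 - p) / (1 - q) ^ 2
    linarith

end Coins

theorem exists_perm_map_eq {α : Type*} {l l' : List α} (hl : l.Nodup)
    (hl' : l'.Nodup) (hlen : l.length = l'.length) : ∃ e : Equiv.Perm α, l.map e = l' := by
  let x : Fin l.length ↪ α := ⟨l.get, List.nodup_iff_injective_get.1 hl⟩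
  let y : Fin l.length ↪ α := ⟨fun i ↦ l'.get (i.cast hlen), fun i j h ↦ by
    simpa using List.nodup_iff_injective_get.1 hl' h⟩
  obtain ⟨e, he⟩ := (Equiv.Perm.isMultiplyPretransitive α l.length).exists_smul_eq x y
  refine ⟨e, List.ext_getElem (by simpa using hlen) fun i hi _ ↦ ?_⟩
  have := DFunLike.congr_fun he ⟨i, by simpa using hi⟩
  simpa [x, y] using this

theorem sum_measureReal_map_equiv_eq {Ω α β : Type*} [MeasurableSpace Ω] [DiscreteMeasurableSpace Ω]
    [Fintype α] [Fintype β] [DecidableEq α] [DecidableEq β]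
    (μ : Measure Ω) [IsFiniteMeasure μ] {T T' : Ω → List α}
    (hT : ∀ ω, (T ω).Nodup) (hTT' : ∀ ω, (T ω).Perm (T' ω)) (A : List β → Prop) :
    ∑ e : α ≃ β, μ.real {ω | A ((T ω).map e)} = ∑ e : α ≃ β, μ.real {ω | A ((T' ω).map e)} := by
  have hcount (U : Ω → List α) : ∑ e : α ≃ β, μ.real {ω | A ((U ω).map e)}
      = ∫ ω, ∑ e : α ≃ β, {l : List β | A l}.indicator 1 ((U ω).map e) ∂μ := by
    rw [integral_finsetSum]
    · refine sum_congr rfl fun e _ ↦ ?_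
      rw [← integral_indicator_one .of_discrete]
      rfl
    · exact fun e _ ↦ (integrable_const (1 : ℝ)).indicator
        (MeasurableSet.of_discrete (s := {ω | A ((U ω).map e)}))
  rw [hcount, hcount]
  congr! 2 with ω
  obtain ⟨ρ, hρ⟩ := exists_perm_map_eq (hT ω) ((hTT' ω).nodup_iff.1 (hT ω)) (hTT' ω).length_eq
  refine Fintype.sum_equiv (Equiv.equivCongr ρ (.refl β)) _ _ fun e ↦ ?_
  have hcomp : ⇑(Equiv.equivCongr ρ (.refl β) e) ∘ ρ = e := by ext; simp
  rw [← hρ, List.map_map, hcomp]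

section Scanning

variable {n : ℕ}

theorem Satisfies.mono {ψ : Assignment n} {F G : Formula n} (h : Satisfies ψ G) (hFG : F ⊆ G) :
    Satisfies ψ F := fun C hC ↦ h C (hFG hC)

theorem Satisfiable.mono {F G : Formula n} (h : Satisfiable G) (hFG : F ⊆ G) :
    Satisfiable F := h.imp fun _ hψ ↦ hψ.mono hFG

theorem satisfiable_empty : Satisfiable (∅ : Formula n) :=
  ⟨fun _ ↦ true, fun C hC ↦ absurd hC (notMem_empty C)⟩

open Classical in
/-- One step of the scan: add the clause `C` to `F` if the result is satisfiable. -/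
noncomputable def tryInsert (F : Formula n) (C : Clause n) : Formula n :=
  if Satisfiable (insert C F) then insert C F else F

/-- The scan of the clauses in `l`, started from the formula `F` instead of the empty one. -/
noncomputable def scan (F : Formula n) (l : List (Clause n)) : Formula n :=
  l.foldl tryInsert F

theorem tryInsert_of_satisfiable {F : Formula n} {C : Clause n} (h : Satisfiable (insert C F)) :
    tryInsert F C = insert C F := if_pos h

theorem tryInsert_of_not_satisfiable {F : Formula n} {C : Clause n}
    (h : ¬ Satisfiable (insert C F)) : tryInsert F C = F := if_neg h

theorem scan_cons (F : Formula n) (C : Clause n) (l : List (Clause n)) :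
    scan F (C :: l) = scan (tryInsert F C) l := rfl

theorem scan_append (F : Formula n) (l l' : List (Clause n)) :
    scan F (l ++ l') = scan (scan F l) l' := List.foldl_append ..

theorem process_eq_scan (σ : Ordering n) (coin : Clause n → Bool) :
    process σ coin = scan ∅ ((List.ofFn σ).filter coin) := by
  rw [scan, List.foldl_filter, process]
  congr! 3 with F C
  split_ifs with hstep hcoin hcoin
  · exact (tryInsert_of_satisfiable hstep.2).symm
  · exact absurd hstep.1 hcoin
  · exact (tryInsert_of_not_satisfiable fun h ↦ hstep ⟨hcoin, h⟩).symm
  · rfl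

theorem subset_tryInsert (F : Formula n) (C : Clause n) : F ⊆ tryInsert F C := by
  by_cases h : Satisfiable (insert C F)
  · rw [tryInsert_of_satisfiable h]
    exact subset_insert C F
  · rw [tryInsert_of_not_satisfiable h]

theorem tryInsert_subset (F : Formula n) (C : Clause n) : tryInsert F C ⊆ insert C F := by
  by_cases h : Satisfiable (insert C F)
  · rw [tryInsert_of_satisfiable h]
  · rw [tryInsert_of_not_satisfiable h]
    exact subset_insert C F

theorem satisfiable_tryInsert {F : Formula n} (hF : Satisfiable F) (C : Clause n) :
    Satisfiable (tryInsert F C) := by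
  by_cases h : Satisfiable (insert C F)
  · rwa [tryInsert_of_satisfiable h]
  · rwa [tryInsert_of_not_satisfiable h]

/-- `G` arises from `F` by adding clauses of `S` until no further clause of `S` can be added
without losing satisfiability. This is all that the analysis of a round uses about the scan. -/
structure IsMaximalExtension (F S G : Formula n) : Prop where
  subset : F ⊆ G
  subset_union : G ⊆ F ∪ S
  satisfiable : Satisfiable G
  mem_of_satisfiable : ∀ C ∈ S, Satisfiable (insert C G) → C ∈ G

theorem IsMaximalExtension.mem_of_satisfies {F S G : Formula n} (hG : IsMaximalExtension F S G)
    {C : Clause n} (hC : C ∈ S) {ψ : Assignment n} (hψ : Satisfies ψ G)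
    (hψC : ∃ l ∈ C.1, ψ l.1 = l.2) : C ∈ G :=
  hG.mem_of_satisfiable C hC ⟨ψ, fun D hD ↦ (mem_insert.1 hD).elim (· ▸ hψC) (hψ D)⟩

theorem isMaximalExtension_scan {F : Formula n} (hF : Satisfiable F) (l : List (Clause n)) :
    IsMaximalExtension F l.toFinset (scan F l) := by
  induction l generalizing F with
  | nil => exact ⟨subset_rfl, by simp [scan], hF, by simp⟩
  | cons C l ih =>
    obtain ⟨hsub, hsup, hsat, hmax⟩ := ih (satisfiable_tryInsert hF C)
    rw [scan_cons]
    refine ⟨(subset_tryInsert F C).trans hsub, hsup.trans ?_, hsat, fun D hD h ↦ ?_⟩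
    · rw [List.toFinset_cons, union_insert, ← insert_union]
      exact union_subset_union_left (tryInsert_subset F C)
    · rcases List.mem_cons.1 (List.mem_toFinset.1 hD) with rfl | hD
      · have hDF : Satisfiable (insert D F) :=
          h.mono (insert_subset_insert D ((subset_tryInsert F D).trans hsub))
        exact hsub (tryInsert_of_satisfiable hDF ▸ mem_insert_self D F)
      · exact hmax D (List.mem_toFinset.2 hD) h

theorem scan_filter_of_mem {F : Formula n} {P : Clause n → Bool}
    (hF : ∀ C, P C = false → Satisfiable (insert C F) → C ∈ F) (l : List (Clause n)) :
    scan F (l.filter P) = scan F l := by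
  induction l generalizing F with
  | nil => rfl
  | cons C l ih =>
    cases hC : P C
    · have hskip : tryInsert F C = F := by
        by_cases h : Satisfiable (insert C F)
        · rw [tryInsert_of_satisfiable h, insert_eq_self.2 (hF C hC h)]
        · exact tryInsert_of_not_satisfiable h
      rw [List.filter_cons_of_neg (by simp [hC]), scan_cons, hskip, ih hF]
    · rw [List.filter_cons_of_pos hC, scan_cons, scan_cons]
      exact ih fun D hD h ↦ subset_tryInsert F C <|
        hF D hD (h.mono (insert_subset_insert D (subset_tryInsert F C)))

end Scanning

section Coupling

/-- The list `l` followed by the elements of `l'` that do not occur in `l`. -/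
def appendNew {α : Type*} [DecidableEq α] (l l' : List α) : List α := l ++ l'.filter (· ∉ l)

theorem scan_appendNew {n : ℕ} {F : Formula n} (hF : Satisfiable F) (l l' : List (Clause n)) :
    scan F (appendNew l l') = scan (scan F l) l' := by
  rw [appendNew, scan_append]
  refine scan_filter_of_mem (fun C hC ↦ ?_) l'
  have hCl : C ∈ l := by simpa using hC
  exact (isMaximalExtension_scan hF l).mem_of_satisfiable C (List.mem_toFinset.2 hCl)

section appendNew

variable {α β : Type*} [DecidableEq α] [DecidableEq β]

theorem mem_appendNew {l l' : List α} {a : α} : a ∈ appendNew l l' ↔ a ∈ l ∨ a ∈ l' := by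
  by_cases ha : a ∈ l <;> simp [appendNew, ha]

theorem nodup_appendNew {l l' : List α} (hl : l.Nodup) (hl' : l'.Nodup) :
    (appendNew l l').Nodup :=
  hl.append (hl'.filter _) fun _ ha ha' ↦ by simp_all

theorem map_appendNew {f : α → β} (hf : f.Injective) (l l' : List α) :
    (appendNew l l').map f = appendNew (l.map f) (l'.map f) := by
  simp only [appendNew, List.map_append, List.filter_map, Function.comp_def,
    List.mem_map_of_injective hf]

/-- The elements of `l` whose coin succeeds in one of three rounds, listed round by round. -/
def byRound (l : List α) (ω : (α → Bool) × (α → Bool) × (α → Bool)) : List α :=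
  appendNew (appendNew (l.filter ω.1) (l.filter ω.2.1)) (l.filter ω.2.2)

theorem filter_or_perm_byRound {l : List α} (hl : l.Nodup)
    (ω : (α → Bool) × (α → Bool) × (α → Bool)) :
    (l.filter fun a ↦ ω.1 a || (ω.2.1 a || ω.2.2 a)).Perm (byRound l ω) := by
  refine (List.perm_ext_iff_of_nodup (hl.filter _) ?_).2 fun a ↦ ?_
  · exact nodup_appendNew (nodup_appendNew (hl.filter _) (hl.filter _)) (hl.filter _)
  · simp only [byRound, mem_appendNew, List.mem_filter, Bool.or_eq_true]
    tauto

theorem byRound_map (e : α ≃ β) (l : List α) (ω : (β → Bool) × (β → Bool) × (β → Bool)) :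
    byRound (l.map e) ω = (byRound l (ω.1 ∘ e, ω.2.1 ∘ e, ω.2.2 ∘ e)).map e := by
  simp only [byRound, map_appendNew e.injective, List.filter_map]

end appendNew

theorem scan_byRound {n : ℕ} (l : List (Clause n))
    (ω : (Clause n → Bool) × (Clause n → Bool) × (Clause n → Bool)) :
    scan ∅ (byRound l ω)
      = scan (scan (scan ∅ (l.filter ω.1)) (l.filter ω.2.1)) (l.filter ω.2.2) := by
  rw [byRound, scan_appendNew satisfiable_empty, scan_appendNew satisfiable_empty]

section ThreeRounds

variable {ι : Type*} [Fintype ι] (q₁ q₂ q₃ : unitInterval)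

/-- Three independent rounds of tosses, with coins of success probabilities `q₁`, `q₂`, `q₃`. -/
noncomputable def threeRounds (ι : Type*) [Fintype ι] (q₁ q₂ q₃ : unitInterval) :
    Measure ((ι → Bool) × (ι → Bool) × (ι → Bool)) :=
  (coinMeasure ι q₁).prod ((coinMeasure ι q₂).prod (coinMeasure ι q₃))

instance : IsProbabilityMeasure (threeRounds ι q₁ q₂ q₃) := by
  unfold threeRounds; infer_instance

theorem measurePreserving_threeRounds_or :
    MeasurePreserving (fun (ω : (ι → Bool) × (ι → Bool) × (ι → Bool)) i ↦
      ω.1 i || (ω.2.1 i || ω.2.2 i)) (threeRounds ι q₁ q₂ q₃)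
      (coinMeasure ι (coinOr q₁ (coinOr q₂ q₃))) :=
  (measurePreserving_coinMeasure_or q₁ _).comp
    ((MeasurePreserving.id _).prod (measurePreserving_coinMeasure_or q₂ q₃))

theorem measurePreserving_threeRounds_comp_equiv {κ : Type*} [Fintype κ] (e : ι ≃ κ) :
    MeasurePreserving (fun ω : (κ → Bool) × (κ → Bool) × (κ → Bool) ↦
      (ω.1 ∘ e, ω.2.1 ∘ e, ω.2.2 ∘ e)) (threeRounds κ q₁ q₂ q₃) (threeRounds ι q₁ q₂ q₃) :=
  (measurePreserving_coinMeasure_comp_equiv q₁ e).prod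
    ((measurePreserving_coinMeasure_comp_equiv q₂ e).prod
      (measurePreserving_coinMeasure_comp_equiv q₃ e))

theorem toMeasure_coins (n : ℕ) (p : unitInterval) :
    (coins n p).toMeasure = coinMeasure (Clause n) p := by
  refine Measure.ext_of_singleton fun b ↦ ?_
  rw [PMF.toMeasure_apply_singleton _ _ (.of_discrete), coinMeasure, Measure.pi_singleton, coins,
    PMF.ofFintype_apply]
  refine prod_congr rfl fun C _ ↦ ?_
  cases b C
  · simp [← ENNReal.ofReal_coe_nnreal]
  · simp [← ENNReal.ofReal_coe_nnreal]

theorem toReal_psat_eq (n : ℕ) (p : unitInterval) (A : Formula n → Prop) :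
    ((Psat n p).toOuterMeasure {F | A F}).toReal = (Fintype.card (Ordering n) : ℝ)⁻¹ *
      ∑ σ : Ordering n, (coinMeasure (Clause n) p).real {b | A (process σ b)} := by
  have hmap (σ : Ordering n) : ((coins n p).map (process σ)).toOuterMeasure {F | A F}
      = coinMeasure (Clause n) p {b | A (process σ b)} := by
    rw [PMF.toOuterMeasure_map_apply, ← toMeasure_coins,
      PMF.toMeasure_apply_eq_toOuterMeasure]
    rfl
  rw [Psat, PMF.toOuterMeasure_bind_apply, tsum_fintype, ENNReal.toReal_sum, mul_sum]
  · refine sum_congr rfl fun σ _ ↦ ?_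
    rw [ENNReal.toReal_mul, hmap, PMF.uniformOfFintype_apply, ENNReal.toReal_inv,
      ENNReal.toReal_natCast, measureReal_def]
  · intro σ _
    rw [hmap]
    exact ENNReal.mul_ne_top (PMF.apply_ne_top _ _) (measure_ne_top _ _)

/-- Given the coins, listing the successful positions round by round instead of in their natural
order only permutes the orderings `σ`. The sum over `σ` is essential: it fails term by term. -/
theorem sum_measureReal_process_eq (n : ℕ) (A : Formula n → Prop) :
    ∑ σ : Ordering n, (coinMeasure (Clause n) (coinOr q₁ (coinOr q₂ q₃))).real
        {b | A (process σ b)}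
      = ∑ σ : Ordering n, (threeRounds (Clause n) q₁ q₂ q₃).real
        {ω | A (scan (scan (scan ∅ ((List.ofFn σ).filter ω.1)) ((List.ofFn σ).filter ω.2.1))
          ((List.ofFn σ).filter ω.2.2))} := by
  have hpositions := sum_measureReal_map_equiv_eq (β := Clause n)
    (threeRounds (Fin (Fintype.card (Clause n))) q₁ q₂ q₃)
    (fun ω ↦ (List.nodup_finRange _).filter _)
    (filter_or_perm_byRound (List.nodup_finRange _)) fun l ↦ A (scan ∅ l)
  convert hpositions using 2 with σ _ σ
  · rw [← ((measurePreserving_coinMeasure_comp_equiv _ σ.symm).comp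
      (measurePreserving_threeRounds_or q₁ q₂ q₃)).measureReal_preimage
      MeasurableSet.of_discrete.nullMeasurableSet]
    congr! 2 with ω
    simp [process_eq_scan, List.ofFn_eq_map, List.filter_map, Function.comp_def]
  · rw [← (measurePreserving_threeRounds_comp_equiv q₁ q₂ q₃ σ).measureReal_preimage
      MeasurableSet.of_discrete.nullMeasurableSet]
    simp only [← scan_byRound, List.ofFn_eq_map, byRound_map, Set.preimage_ofPred_eq]

theorem toReal_psat_le (n : ℕ) (A : Formula n → Prop) {δ : ℝ}
    (hδ : ∀ σ : Ordering n, (threeRounds (Clause n) q₁ q₂ q₃).real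
        {ω | A (scan (scan (scan ∅ ((List.ofFn σ).filter ω.1)) ((List.ofFn σ).filter ω.2.1))
          ((List.ofFn σ).filter ω.2.2))} ≤ δ) :
    ((Psat n (coinOr q₁ (coinOr q₂ q₃))).toOuterMeasure {F | A F}).toReal ≤ δ := by
  rw [toReal_psat_eq]
  have hN : (0 : ℝ) < Fintype.card (Ordering n) := mod_cast Fintype.card_pos
  rw [sum_measureReal_process_eq, inv_mul_le_iff₀ hN, ← nsmul_eq_mul]
  exact sum_le_card_nsmul _ _ _ fun σ _ ↦ hδ σ

end ThreeRounds

end Coupling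

section Clauses

variable {n : ℕ}

/-- The set of variables of a clause. -/
def clauseVars (C : Clause n) : Finset (Fin n) := C.1.image Prod.fst

theorem card_clauseVars (C : Clause n) : #(clauseVars C) = 3 := C.2.2

theorem fst_mem_clauseVars {C : Clause n} {l : Literal n} (h : l ∈ C.1) : l.1 ∈ clauseVars C :=
  mem_image_of_mem _ h

/-- The clauses whose set of variables belongs to `T` and whose literals are all true
under `χ`. -/
def aligned (χ : Assignment n) (T : Finset (Finset (Fin n))) : Finset (Clause n) :=
  {C | clauseVars C ∈ T ∧ ∀ l ∈ C.1, l.2 = χ l.1}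

theorem mem_aligned {χ : Assignment n} {T : Finset (Finset (Fin n))} {C : Clause n} :
    C ∈ aligned χ T ↔ clauseVars C ∈ T ∧ ∀ l ∈ C.1, l.2 = χ l.1 := by
  simp [aligned]

theorem mk_mem_of_mem_aligned {χ : Assignment n} {T : Finset (Finset (Fin n))} {C : Clause n}
    (hC : C ∈ aligned χ T) {x : Fin n} (hx : x ∈ clauseVars C) : (x, χ x) ∈ C.1 := by
  obtain ⟨l, hl, rfl⟩ := mem_image.1 hx
  rwa [← (mem_aligned.1 hC).2 l hl]

theorem card_le_card_aligned (χ : Assignment n) {T : Finset (Finset (Fin n))}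
    (hT : ∀ t ∈ T, #t = 3) : #T ≤ #(aligned χ T) := by
  refine card_le_card_of_surjOn clauseVars fun t ht ↦ ?_
  have hvars : (t.image fun y ↦ (y, χ y)).image Prod.fst = t := by
    simp [image_image, Function.comp_def]
  have hcard : #(t.image fun y ↦ (y, χ y)) = 3 := by
    rw [card_image_of_injective _ fun a b h ↦ congrArg Prod.fst h, hT t ht]
  let C : Clause n := ⟨t.image fun y ↦ (y, χ y), hcard, by rw [hvars, hT t ht]⟩
  have hC : clauseVars C = t := hvars
  refine ⟨C, mem_coe.2 (mem_aligned.2 ⟨by rwa [hC], fun l hl ↦ ?_⟩), hC⟩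
  obtain ⟨y, -, rfl⟩ := mem_image.1 hl
  rfl

/-- The sets consisting of an element of `X` and two elements of `Y`. -/
def star (X Y : Finset (Fin n)) : Finset (Finset (Fin n)) :=
  (X ×ˢ Y.powersetCard 2).image fun a ↦ insert a.1 a.2

theorem mem_star {X Y t : Finset (Fin n)} :
    t ∈ star X Y ↔ ∃ x ∈ X, ∃ u ⊆ Y, #u = 2 ∧ insert x u = t := by
  simp [star, and_assoc]

theorem card_star {X Y : Finset (Fin n)} (h : Disjoint X Y) :
    #(star X Y) = #X * (#Y).choose 2 := by
  rw [star, card_image_of_injOn, card_product, card_powersetCard]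
  rintro ⟨x, u⟩ hxu ⟨x', u'⟩ hxu' heq
  simp only [coe_product, Set.mem_prod, mem_coe, mem_powersetCard] at hxu hxu' heq
  have hx : x ∉ u' := fun hx ↦ disjoint_left.1 h hxu.1 (hxu'.2.1 hx)
  obtain rfl : x = x' := by
    have hmem : x ∈ insert x' u' := heq ▸ mem_insert_self x u
    exact (mem_insert.1 hmem).resolve_right hx
  have hxu : x ∉ u := fun hx ↦ disjoint_left.1 h hxu.1 (hxu.2.1 hx)
  rw [← erase_insert hxu, heq, erase_insert hx]

theorem card_le_card_aligned_star (χ : Assignment n) {X Y : Finset (Fin n)} (h : Disjoint X Y) :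
    #X * (#Y).choose 2 ≤ #(aligned χ (star X Y)) := by
  rw [← card_star h]
  refine card_le_card_aligned χ fun t ht ↦ ?_
  obtain ⟨x, hx, u, hu, hu2, rfl⟩ := mem_star.1 ht
  rw [card_insert_of_notMem fun hxu ↦ disjoint_left.1 h hx (hu hxu), hu2]

/-- The clauses in which the variable `x` appears. -/
def clausesAt (x : Fin n) : Finset (Clause n) := {C | x ∈ clauseVars C}

theorem mem_clausesAt {x : Fin n} {C : Clause n} : C ∈ clausesAt x ↔ x ∈ clauseVars C := by
  simp [clausesAt]

theorem card_clausesAt_le (x : Fin n) : #(clausesAt x) ≤ 8 * n ^ 2 := by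
  have hsub : (clausesAt x).map (Function.Embedding.subtype _) ⊆
      (univ : Finset (Bool × Literal n × Literal n)).image
        fun a ↦ {(x, a.1), a.2.1, a.2.2} := by
    intro S hS
    obtain ⟨C, hC, rfl⟩ := mem_map.1 hS
    obtain ⟨⟨y, b⟩, hl, rfl⟩ := mem_image.1 (mem_clausesAt.1 hC)
    obtain ⟨l₁, l₂, -, h⟩ := card_eq_two.1 (by rw [card_erase_of_mem hl, C.2.1])
    refine mem_image.2 ⟨(b, l₁, l₂), mem_univ _, ?_⟩
    exact (congrArg (insert (y, b)) h).symm.trans (insert_erase hl)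
  rw [← card_map (Function.Embedding.subtype _)]
  refine (card_le_card hsub).trans (card_image_le.trans_eq ?_)
  simp only [card_univ, Fintype.card_prod, Fintype.card_bool, Fintype.card_fin]
  ring

/-- Negation of the variable `x` in literals. -/
def flipLiteral (x : Fin n) : Literal n ↪ Literal n where
  toFun l := (l.1, if l.1 = x then !l.2 else l.2)
  inj' := by
    rintro ⟨y, b⟩ ⟨z, c⟩ h
    obtain ⟨rfl, h⟩ := Prod.mk.inj h
    split_ifs at h <;> simp_all

/-- Negation of the variable `x` in clauses. -/
def flipClause (x : Fin n) (C : Clause n) : Clause n :=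
  ⟨C.1.map (flipLiteral x), by rw [card_map]; exact C.2.1, by
    rw [map_eq_image, image_image]
    exact C.2.2⟩

theorem card_occurrences_univ_le (x : Fin n) (b : Bool) :
    #(occurrences univ (x, b)) ≤ #(occurrences univ (x, !b)) := by
  refine card_le_card_of_injOn (flipClause x) (fun C hC ↦ ?_) fun C _ D _ h ↦ ?_
  · refine mem_filter.2 ⟨mem_univ _, mem_map.2 ⟨(x, b), (mem_filter.1 hC).2, ?_⟩⟩
    exact congrArg (Prod.mk x) (if_pos rfl)
  · exact Subtype.ext (map_injective _ (Subtype.ext_iff.1 h))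

theorem card_occurrences_univ_not (x : Fin n) (b : Bool) :
    #(occurrences univ (x, !b)) = #(occurrences univ (x, b)) :=
  le_antisymm (by simpa using card_occurrences_univ_le x (!b)) (card_occurrences_univ_le x b)

end Clauses

section Frozen

variable {n : ℕ}

/-- All satisfying assignments of `F` agree on the variable `x`. -/
def Frozen (F : Formula n) (x : Fin n) : Prop :=
  ∀ ψ φ : Assignment n, Satisfies ψ F → Satisfies φ F → ψ x = φ x

theorem Frozen.mono {F G : Formula n} {x : Fin n} (h : Frozen F x) (hFG : F ⊆ G) : Frozen G x :=
  fun ψ φ hψ hφ ↦ h ψ φ (hψ.mono hFG) (hφ.mono hFG)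

theorem frozen_of_forall_eq {F : Formula n} {x : Fin n} {b : Bool}
    (h : ∀ ψ, Satisfies ψ F → ψ x = b) : Frozen F x :=
  fun ψ φ hψ hφ ↦ (h ψ hψ).trans (h φ hφ).symm

open Classical in
/-- The set of variables that are not frozen. -/
noncomputable def unfrozen (F : Formula n) : Finset (Fin n) := {x | ¬ Frozen F x}

theorem mem_unfrozen {F : Formula n} {x : Fin n} : x ∈ unfrozen F ↔ ¬ Frozen F x := by
  simp [unfrozen]

theorem mem_compl_unfrozen {F : Formula n} {x : Fin n} : x ∈ (unfrozen F)ᶜ ↔ Frozen F x := by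
  rw [mem_compl, mem_unfrozen, not_not]

theorem unfrozen_anti {F G : Formula n} (h : F ⊆ G) : unfrozen G ⊆ unfrozen F := fun _ hx ↦
  mem_unfrozen.2 fun hF ↦ mem_unfrozen.1 hx (hF.mono h)

end Frozen

section FirstRound

theorem exists_card_lt_forall_subset {V : Type*} [Finite V] [DecidableEq V]
    {P : Finset V → Prop} {a : ℕ} (hempty : P ∅) (hunion : ∀ D E, P D → P E → P (D ∪ E))
    (hgap : ∀ D, P D → #D ≤ 2 * a → #D < a) : ∃ U, #U < a ∧ ∀ D, P D → #D < a → D ⊆ U := by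
  classical
  have := Fintype.ofFinite V
  let small : Finset (Finset V) := {D | P D ∧ #D < a}
  have hsup : P (small.sup id) ∧ #(small.sup id) < a := by
    refine sup_induction (p := fun D ↦ P D ∧ #D < a) ⟨hempty, hgap ∅ hempty (by simp)⟩
      (fun D hD E hE ↦ ?_) fun D hD ↦ (mem_filter.1 hD).2
    have hcard : #(D ∪ E) ≤ #D + #E := card_union_le D E
    have hDE := hunion D E hD.1 hE.1
    exact ⟨hDE, hgap (D ∪ E) hDE (by lia)⟩
  exact ⟨small.sup id, hsup.2, fun D hD hDa ↦
    le_sup (f := id) (mem_filter.2 ⟨mem_univ D, hD, hDa⟩)⟩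

variable {n : ℕ}

/-- The assignment that agrees with `φ` on `D` and disagrees with `φ` off `D`. -/
def agreeOn (φ : Assignment n) (D : Finset (Fin n)) : Assignment n :=
  fun x ↦ if x ∈ D then φ x else !φ x

/-- `S` contains no clause with exactly one variable in `D` whose literal on this variable is its
only literal that is true under `φ`: no clause of `S` prevents `D` from being flipped because of a
single variable of `D`. -/
def SelfSupporting (φ : Assignment n) (S : Formula n) (D : Finset (Fin n)) : Prop :=
  Disjoint S (aligned (agreeOn φ D) (star D Dᶜ))

theorem selfSupporting_empty (φ : Assignment n) (S : Formula n) : SelfSupporting φ S ∅ := by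
  simp [SelfSupporting, aligned, star]

theorem mem_aligned_agreeOn_star_of_subset {φ : Assignment n} {D E u : Finset (Fin n)}
    (hDE : D ⊆ E) {C : Clause n} {x : Fin n} (hx : x ∈ D) (hu : u ⊆ Eᶜ) (hu2 : #u = 2)
    (hvars : insert x u = clauseVars C) (hC : ∀ l ∈ C.1, l.2 = agreeOn φ E l.1) :
    C ∈ aligned (agreeOn φ D) (star D Dᶜ) := by
  have huD : u ⊆ Dᶜ := hu.trans (compl_subset_compl.2 hDE)
  refine mem_aligned.2 ⟨mem_star.2 ⟨x, hx, u, huD, hu2, hvars⟩, fun l hl ↦ ?_⟩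
  have hiff : l.1 ∈ E ↔ l.1 ∈ D := by
    rcases mem_insert.1 (hvars ▸ fst_mem_clauseVars hl) with h | h
    · simp [h, hx, hDE hx]
    · simp [mem_compl.1 (hu h), mem_compl.1 (huD h)]
  rw [hC l hl, agreeOn, agreeOn, if_congr hiff rfl rfl]

theorem SelfSupporting.union {φ : Assignment n} {S : Formula n} {D E : Finset (Fin n)}
    (hD : SelfSupporting φ S D) (hE : SelfSupporting φ S E) : SelfSupporting φ S (D ∪ E) := by
  refine disjoint_right.2 fun C hC ↦ ?_
  obtain ⟨hvars, hlit⟩ := mem_aligned.1 hC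
  obtain ⟨x, hx, u, hu, hu2, h⟩ := mem_star.1 hvars
  rcases mem_union.1 hx with hx | hx
  · exact disjoint_right.1 hD
      (mem_aligned_agreeOn_star_of_subset subset_union_left hx hu hu2 h hlit)
  · exact disjoint_right.1 hE
      (mem_aligned_agreeOn_star_of_subset subset_union_right hx hu hu2 h hlit)

theorem IsMaximalExtension.selfSupporting {F S G : Formula n} (hG : IsMaximalExtension F S G)
    {φ ψ : Assignment n} (hφ : Satisfies φ G) (hψ : Satisfies ψ G) :
    SelfSupporting φ S {x | ψ x ≠ φ x} := by
  refine disjoint_right.2 fun C hC hCS ↦ ?_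
  obtain ⟨hvars, hlit⟩ := mem_aligned.1 hC
  obtain ⟨x, hx, u, -, -, h⟩ := mem_star.1 hvars
  have hxC := mk_mem_of_mem_aligned hC (h ▸ mem_insert_self x u)
  have hCG : C ∈ G := hG.mem_of_satisfies hCS hφ ⟨_, hxC, (if_pos hx).symm⟩
  obtain ⟨l, hl, hψl⟩ := hψ C hCG
  rw [hlit l hl, agreeOn] at hψl
  split_ifs at hψl with hl' <;> simp_all

theorem IsMaximalExtension.disjoint_aligned {F S G : Formula n}
    (hG : IsMaximalExtension F S G) {φ ψ : Assignment n} (hφ : Satisfies φ G)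
    (hψ : Satisfies ψ G) :
    Disjoint S (aligned φ (powersetCard 3 {x | ψ x ≠ φ x})) := by
  refine disjoint_right.2 fun C hC hCS ↦ ?_
  obtain ⟨hvars, hlit⟩ := mem_aligned.1 hC
  obtain ⟨l, hl⟩ : C.1.Nonempty := card_pos.1 (by rw [C.2.1]; norm_num)
  have hCG : C ∈ G := hG.mem_of_satisfies hCS hφ ⟨l, hl, (hlit l hl).symm⟩
  obtain ⟨l', hl', hψl'⟩ := hψ C hCG
  have hne := (mem_powersetCard.1 hvars).1 (fst_mem_clauseVars hl')
  exact (mem_filter.1 hne).2 (hψl'.trans (hlit l' hl'))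

theorem IsMaximalExtension.card_unfrozen_lt {F S G : Formula n} (hG : IsMaximalExtension F S G)
    {a : ℕ} (hlarge : ∀ (φ : Assignment n) (D : Finset (Fin n)), a ≤ #D →
      ¬ Disjoint S (aligned φ (powersetCard 3 D)))
    (hmiddle : ∀ (φ : Assignment n) (D : Finset (Fin n)), a ≤ #D → #D ≤ 2 * a →
      ¬ SelfSupporting φ S D) : #(unfrozen G) < a := by
  obtain ⟨φ, hφ⟩ := hG.satisfiable
  obtain ⟨U, hUa, hU⟩ := exists_card_lt_forall_subset (selfSupporting_empty φ S)
    (fun D E ↦ SelfSupporting.union) fun D hD hDa ↦ not_le.1 fun h ↦ hmiddle φ D h hDa hD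
  refine (card_le_card fun x hx ↦ ?_).trans_lt hUa
  by_contra hxU
  refine mem_unfrozen.1 hx (frozen_of_forall_eq (b := φ x) fun ψ hψ ↦ ?_)
  have hsmall : #{x | ψ x ≠ φ x} < a :=
    not_le.1 fun h ↦ hlarge φ _ h (hG.disjoint_aligned hφ hψ)
  by_contra hne
  exact hxU (hU _ (hG.selfSupporting hφ hψ) hsmall (by simpa using hne))

theorem measureReal_exists_disjoint_heads_le_four_pow (q : unitInterval)
    (J : Finset (Assignment n × Finset (Fin n)))
    (T : Assignment n → Finset (Fin n) → Finset (Clause n)) {t : ℕ}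
    (hT : ∀ j ∈ J, t ≤ #(T j.1 j.2)) :
    (coinMeasure (Clause n) q).real {b | ∃ j ∈ J, Disjoint (heads b) (T j.1 j.2)}
      ≤ 4 ^ n * exp (-(q * t)) := by
  have hcard : #J ≤ 4 ^ n := by
    refine (card_le_univ J).trans_eq ?_
    simp [← mul_pow]
  refine (measureReal_exists_disjoint_heads_le q J _ hT).trans ?_
  gcongr
  exact_mod_cast hcard

theorem measureReal_card_unfrozen_ge_le (q : unitInterval) {F : Formula n}
    {ext : (Clause n → Bool) → Formula n} (hext : ∀ b, IsMaximalExtension F (heads b) (ext b))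
    {a t : ℕ} (ht₁ : t ≤ a.choose 3) (ht₂ : t ≤ a * (n - 2 * a).choose 2) :
    (coinMeasure (Clause n) q).real {b | a ≤ #(unfrozen (ext b))}
      ≤ 2 * (4 ^ n * exp (-(q * t))) := by
  let large : Finset (Assignment n × Finset (Fin n)) := {j | a ≤ #j.2}
  let middle : Finset (Assignment n × Finset (Fin n)) := {j | a ≤ #j.2 ∧ #j.2 ≤ 2 * a}
  have hlarge := measureReal_exists_disjoint_heads_le_four_pow q large
    (fun φ D ↦ aligned φ (powersetCard 3 D)) fun j hj ↦ by
      refine ht₁.trans ((Nat.choose_le_choose 3 (mem_filter.1 hj).2).trans ?_)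
      rw [← card_powersetCard]
      exact card_le_card_aligned _ fun s hs ↦ (mem_powersetCard.1 hs).2
  have hmiddle := measureReal_exists_disjoint_heads_le_four_pow q middle
    (fun φ D ↦ aligned (agreeOn φ D) (star D Dᶜ)) fun j hj ↦ by
      obtain ⟨haD, hDa⟩ := (mem_filter.1 hj).2
      refine ht₂.trans (le_trans ?_ (card_le_card_aligned_star _ disjoint_compl_right))
      rw [card_compl, Fintype.card_fin]
      exact Nat.mul_le_mul haD (Nat.choose_le_choose 2 (by lia))
  rw [two_mul]
  refine (measureReal_mono fun b hb ↦ ?_).trans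
    ((measureReal_union_le _ _).trans (add_le_add hlarge hmiddle))
  by_contra hgood
  simp only [Set.mem_union, Set.mem_ofPred_eq, not_or, not_exists, not_and] at hgood
  refine ((hext b).card_unfrozen_lt (a := a) ?_ ?_).not_ge hb
  · exact fun φ D hD ↦ hgood.1 (φ, D) (by simpa [large] using hD)
  · exact fun φ D hD hD' ↦ hgood.2 (φ, D) (by simp [middle, hD, hD'])

end FirstRound

section SecondRound

variable {n : ℕ}

/-- If `C` is accepted, it forces `x` to take the value `!φ x`. If it is rejected, then `x` keeps
the value `φ x`, since a satisfying assignment with the other value would have let `C` in. -/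
theorem IsMaximalExtension.frozen_of_mem_aligned {F S G : Formula n}
    (hG : IsMaximalExtension F S G) {φ : Assignment n} (hφ : Satisfies φ F) {C : Clause n}
    (hCS : C ∈ S) {x : Fin n} {u : Finset (Fin n)} (hu : ∀ y ∈ u, Frozen F y)
    (hvars : clauseVars C = insert x u) (hlit : ∀ l ∈ C.1, l.2 = !φ l.1) : Frozen G x := by
  by_cases hC : C ∈ G
  · refine frozen_of_forall_eq (b := !φ x) fun ψ hψ ↦ ?_
    obtain ⟨l, hl, hψl⟩ := hψ C hC
    rw [hlit l hl] at hψl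
    rcases mem_insert.1 (hvars ▸ fst_mem_clauseVars hl) with h | h
    · rwa [h] at hψl
    · simp [hu _ h ψ φ (hψ.mono hG.subset) hφ] at hψl
  · refine frozen_of_forall_eq (b := φ x) fun ψ hψ ↦ ?_
    obtain ⟨l, hl, rfl⟩ := mem_image.1 (hvars ▸ mem_insert_self x u : x ∈ clauseVars C)
    by_contra hne
    exact hC (hG.mem_of_satisfies hCS hψ ⟨l, hl, (Bool.eq_not_of_ne hne).trans (hlit l hl).symm⟩)

theorem measureReal_subset_unfrozen_le (q : unitInterval) {F : Formula n} (hF : Satisfiable F)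
    {ext : (Clause n → Bool) → Formula n} (hext : ∀ b, IsMaximalExtension F (heads b) (ext b))
    (X : Finset (Fin n)) :
    (coinMeasure (Clause n) q).real {b | X ⊆ unfrozen (ext b)}
      ≤ exp (-(q * (#X * (#(unfrozen F)ᶜ).choose 2 : ℕ))) := by
  obtain ⟨φ, hφ⟩ := hF
  by_cases hX : Disjoint X (unfrozen F)ᶜ
  · have hmissed : {b | X ⊆ unfrozen (ext b)}
        ⊆ {b | Disjoint (heads b) (aligned (fun x ↦ !φ x) (star X (unfrozen F)ᶜ))} := by
      refine fun b hb ↦ disjoint_right.2 fun C hC hCb ↦ ?_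
      obtain ⟨hvars, hlit⟩ := mem_aligned.1 hC
      obtain ⟨x, hx, u, hu, -, h⟩ := mem_star.1 hvars
      exact mem_unfrozen.1 (hb hx) ((hext b).frozen_of_mem_aligned hφ hCb
        (fun y hy ↦ mem_compl_unfrozen.1 (hu hy)) h.symm hlit)
    refine (measureReal_mono hmissed).trans ((measureReal_disjoint_heads_le q _).trans ?_)
    have := q.2.1
    gcongr
    exact card_le_card_aligned_star _ hX
  · have hempty : {b | X ⊆ unfrozen (ext b)} = ∅ :=
      Set.eq_empty_of_forall_notMem fun b hb ↦ hX <| disjoint_compl_right_iff.2 <|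
        hb.trans (unfrozen_anti (hext b).subset)
    rw [hempty, measureReal_empty]
    positivity

end SecondRound

section Crowded

variable {n : ℕ}

/-- The variables that appear in more than `r` clauses of `S`. -/
noncomputable def crowded (r : ℝ) (S : Formula n) : Finset (Fin n) := {x | r < #(S ∩ clausesAt x)}

theorem sum_ite_mem_clausesAt (C : Clause n) : ∑ x, (if C ∈ clausesAt x then 1 else 0 : ℝ) = 3 := by
  simp [mem_clausesAt, card_clauseVars]

theorem sum_clauses_ite_mem_clausesAt_le (x : Fin n) :
    ∑ C, (if C ∈ clausesAt x then 1 else 0 : ℝ) ≤ 8 * n ^ 2 := by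
  rw [sum_ite_mem, univ_inter, sum_const, nsmul_one]
  exact_mod_cast card_clausesAt_le x

theorem measureReal_subset_crowded_le (q : unitInterval) (r : ℝ) (X : Finset (Fin n)) :
    (coinMeasure (Clause n) q).real {b | X ⊆ crowded r (heads b)}
      ≤ exp (-((r / 4 - 7 / 2 * (n ^ 2 * q)) * #X)) := by
  have habs (x : Fin n) (C : Clause n) : |if C ∈ clausesAt x then (1 : ℝ) else 0|
      = if C ∈ clausesAt x then 1 else 0 := abs_of_nonneg (by positivity)
  have hchernoff := measureReal_forall_mem_sum_heads_ge_le q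
    (fun (x : Fin n) C ↦ if C ∈ clausesAt x then (1 : ℝ) else 0) (M := 8 * n ^ 2) (k := 3)
    (K := 8 * n ^ 2) (θ := 1 / 4) sum_clauses_ite_mem_clausesAt_le
    (fun C ↦ by simp only [habs, sum_ite_mem_clausesAt, le_refl])
    (fun x ↦ by simp only [habs, sum_clauses_ite_mem_clausesAt_le])
    (by norm_num) (by norm_num) (by norm_num) r X
  refine (measureReal_mono fun b hb x hx ↦ ?_).trans (hchernoff.trans_eq (by ring_nf))
  rw [sum_ite_mem, sum_const, nsmul_one]
  exact (mem_filter.1 (hb hx)).2.le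

end Crowded

section ThirdRound

variable {n : ℕ}

/-- The clauses that contain the literal on `x` that is false under `φ`, except for those that are
false under `φ` and whose other variables belong to `Z`. If the variables in `Z` and `x` are frozen,
then the excepted clauses are never accepted. -/
def opposing (φ : Assignment n) (Z : Finset (Fin n)) (x : Fin n) : Finset (Clause n) :=
  occurrences univ (x, !φ x) \ aligned (fun y ↦ !φ y) (star {x} (Z.erase x))

theorem occurrences_univ_subset_clausesAt (x : Fin n) (b : Bool) :
    occurrences univ (x, b) ⊆ clausesAt x := fun _ hC ↦
  mem_clausesAt.2 (fst_mem_clauseVars (mem_filter.1 hC).2)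

theorem opposing_subset_clausesAt (φ : Assignment n) (Z : Finset (Fin n)) (x : Fin n) :
    opposing φ Z x ⊆ clausesAt x :=
  sdiff_subset.trans (occurrences_univ_subset_clausesAt x _)

theorem card_opposing_add_le (φ : Assignment n) (Z : Finset (Fin n)) (x : Fin n) :
    #(opposing φ Z x) + (#Z - 1).choose 2 ≤ #(occurrences univ (x, φ x)) := by
  have hsub : aligned (fun y ↦ !φ y) (star {x} (Z.erase x)) ⊆ occurrences univ (x, !φ x) := by
    intro C hC
    obtain ⟨z, hz, u, -, -, h⟩ := mem_star.1 (mem_aligned.1 hC).1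
    obtain rfl := mem_singleton.1 hz
    exact mem_filter.2 ⟨mem_univ _, mk_mem_of_mem_aligned hC (h ▸ mem_insert_self z u)⟩
  have hexcepted : (#Z - 1).choose 2 ≤ #(aligned (fun y ↦ !φ y) (star {x} (Z.erase x))) :=
    calc (#Z - 1).choose 2 ≤ #{x} * (#(Z.erase x)).choose 2 := by
          rw [card_singleton, one_mul]
          exact Nat.choose_le_choose 2 pred_card_le_card_erase
      _ ≤ _ := card_le_card_aligned_star _ (by simp)
  rw [← card_occurrences_univ_not, ← card_sdiff_add_card_eq_card hsub]
  exact Nat.add_le_add_left hexcepted _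

/-- The variables for which the number of clauses of `S` that contain the literal that is true under
`φ` exceeds the number of opposing ones by at most `ρ`. -/
noncomputable def contested (φ : Assignment n) (Z : Finset (Fin n)) (ρ : ℝ) (S : Formula n) :
    Finset (Fin n) :=
  {x | (#(S ∩ occurrences univ (x, φ x)) : ℝ) ≤ #(S ∩ opposing φ Z x) + ρ}

theorem measureReal_subset_contested_le (q : unitInterval) (φ : Assignment n)
    {Z : Finset (Fin n)} (hZ : (n : ℝ) ^ 2 / 4 ≤ (#Z - 1).choose 2) (ρ : ℝ)
    (X : Finset (Fin n)) :
    (coinMeasure (Clause n) q).real {b | X ⊆ contested φ Z ρ (heads b)}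
      ≤ exp (-((13 / 20000 * (n ^ 2 * q) - ρ / 200) * #X)) := by
  let v (x : Fin n) (C : Clause n) : ℝ :=
    (if C ∈ opposing φ Z x then 1 else 0) - if C ∈ occurrences univ (x, φ x) then 1 else 0
  have hv (x : Fin n) (C : Clause n) : |v x C| ≤ if C ∈ clausesAt x then 1 else 0 := by
    have hopposing := @opposing_subset_clausesAt n φ Z x C
    have hoccurrences := @occurrences_univ_subset_clausesAt n x (φ x) C
    simp only [v]
    split_ifs <;> simp_all
  have hdrift (x : Fin n) : ∑ C, v x C ≤ -(n ^ 2 / 4) := by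
    have hcard : (#(opposing φ Z x) + (#Z - 1).choose 2 : ℝ) ≤ #(occurrences univ (x, φ x)) :=
      mod_cast card_opposing_add_le φ Z x
    simp only [v, sum_sub_distrib, sum_ite_mem, univ_inter, sum_const, nsmul_one]
    linarith
  -- With `θ = 1 / 200`, the drift `θ / 4` outweighs the second-order term `24 * θ ^ 2`.
  have hchernoff := measureReal_forall_mem_sum_heads_ge_le q v (k := 3) (K := 8 * n ^ 2)
    (θ := 1 / 200) hdrift
    (fun C ↦ (sum_le_sum fun x _ ↦ hv x C).trans_eq (sum_ite_mem_clausesAt C))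
    (fun x ↦ (sum_le_sum fun C _ ↦ hv x C).trans (sum_clauses_ite_mem_clausesAt_le x))
    (by norm_num) (by norm_num) (by norm_num) (-ρ) X
  refine (measureReal_mono fun b hb x hx ↦ ?_).trans (hchernoff.trans_eq (by ring_nf))
  have hcontested := (mem_filter.1 (hb hx)).2
  simp only [v, sum_sub_distrib, sum_ite_mem, sum_const, nsmul_one]
  linarith

theorem maj_eq_of_card_lt {F : Formula n} {x : Fin n} {b : Bool}
    (h : #(occurrences F (x, !b)) < #(occurrences F (x, b))) : maj F x = b := by
  cases b
  · exact decide_eq_false h.not_gt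
  · exact decide_eq_true h

theorem IsMaximalExtension.inter_occurrences_subset {F S G : Formula n}
    (hG : IsMaximalExtension F S G) {ψ : Assignment n} (hψ : Satisfies ψ G) (x : Fin n) :
    S ∩ occurrences univ (x, ψ x) ⊆ occurrences G (x, ψ x) := by
  intro C hC
  obtain ⟨hCS, hxC⟩ := mem_inter.1 hC
  have hlit := (mem_filter.1 hxC).2
  exact mem_filter.2 ⟨hG.mem_of_satisfies hCS hψ ⟨_, hlit, rfl⟩, hlit⟩

theorem occurrences_subset_opposing {F : Formula n} {φ ψ : Assignment n} (hψ : Satisfies ψ F)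
    {Z : Finset (Fin n)} (hZ : ∀ y ∈ Z, ψ y = φ y) {x : Fin n} (hx : ψ x = φ x) :
    occurrences F (x, !φ x) ⊆ opposing φ Z x := by
  intro C hC
  obtain ⟨hCF, hxC⟩ := mem_filter.1 hC
  refine mem_sdiff.2 ⟨mem_filter.2 ⟨mem_univ _, hxC⟩, fun hfalse ↦ ?_⟩
  obtain ⟨hvars, hlit⟩ := mem_aligned.1 hfalse
  obtain ⟨z, hz, u, hu, -, h⟩ := mem_star.1 hvars
  obtain ⟨l, hl, hψl⟩ := hψ C hCF
  have hagree : ψ l.1 = φ l.1 := by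
    rcases mem_insert.1 (h ▸ fst_mem_clauseVars hl) with h | h
    · rwa [h, mem_singleton.1 hz]
    · exact hZ _ (mem_of_mem_erase (hu h))
  rw [hlit l hl, hagree] at hψl
  exact Bool.not_ne_self _ hψl.symm

theorem maj_eq_of_notMem_contested {S₁ S₂ S₃ F G : Formula n} (hF : F ⊆ S₁ ∪ S₂)
    (hG : IsMaximalExtension F S₃ G) {φ ψ : Assignment n} (hφ : Satisfies φ F)
    (hψ : Satisfies ψ G) {r : ℝ} {x : Fin n} (hx : x ∉ unfrozen F) (h₁ : x ∉ crowded r S₁)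
    (h₂ : x ∉ crowded r S₂) (h₃ : x ∉ contested φ (unfrozen F)ᶜ (2 * r) S₃) :
    maj G x = ψ x := by
  have hagree : ∀ y ∈ (unfrozen F)ᶜ, ψ y = φ y := fun y hy ↦
    mem_compl_unfrozen.1 hy ψ φ (hψ.mono hG.subset) hφ
  have hψx : ψ x = φ x := hagree x (mem_compl.2 hx)
  have hopposing : occurrences G (x, !φ x) ⊆
      S₁ ∩ clausesAt x ∪ S₂ ∩ clausesAt x ∪ S₃ ∩ opposing φ (unfrozen F)ᶜ x := by
    intro C hC
    have hCopp := occurrences_subset_opposing hψ hagree hψx hC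
    have hCat := opposing_subset_clausesAt _ _ _ hCopp
    have hCS := union_subset_union_left hF (hG.subset_union (mem_filter.1 hC).1)
    simp only [mem_union, mem_inter] at hCS ⊢
    exact hCS.imp (Or.imp (⟨·, hCat⟩) (⟨·, hCat⟩)) (⟨·, hCopp⟩)
  have hcard : (#(occurrences G (x, !φ x)) : ℝ) ≤
      #(S₁ ∩ clausesAt x) + #(S₂ ∩ clausesAt x) + #(S₃ ∩ opposing φ (unfrozen F)ᶜ x) := by
    exact_mod_cast (card_le_card hopposing).trans <| (card_union_le _ _).trans <|
      Nat.add_le_add_right (card_union_le _ _) _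
  have hsupporting : (#(S₃ ∩ occurrences univ (x, φ x)) : ℝ) ≤ #(occurrences G (x, φ x)) := by
    rw [← hψx]
    exact_mod_cast card_le_card (hG.inter_occurrences_subset hψ x)
  simp only [crowded, contested, mem_filter, mem_univ, true_and, not_lt, not_le] at h₁ h₂ h₃
  refine maj_eq_of_card_lt ?_
  rw [hψx, ← Nat.cast_lt (α := ℝ)]
  linarith

theorem majClose_of_card_le {S₁ S₂ S₃ F G : Formula n} (hF : F ⊆ S₁ ∪ S₂)
    (hG : IsMaximalExtension F S₃ G) {φ : Assignment n} (hφ : Satisfies φ F) {r s : ℝ}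
    (hu : #(unfrozen F) ≤ s / 4) (h₁ : #(crowded r S₁) ≤ s / 4) (h₂ : #(crowded r S₂) ≤ s / 4)
    (h₃ : #(contested φ (unfrozen F)ᶜ (2 * r) S₃) ≤ s / 4) : MajClose G s := by
  intro ψ hψ
  have hsub : ({x | ψ x ≠ maj G x} : Finset (Fin n)) ⊆ (unfrozen F ∪ crowded r S₁) ∪
      (crowded r S₂ ∪ contested φ (unfrozen F)ᶜ (2 * r) S₃) := by
    intro x hx
    by_contra hgood
    simp only [mem_union, not_or] at hgood
    obtain ⟨⟨hxu, hx₁⟩, hx₂, hx₃⟩ := hgood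
    exact (mem_filter.1 hx).2 (maj_eq_of_notMem_contested hF hG hφ hψ hxu hx₁ hx₂ hx₃).symm
  have hcard : (hammingDist ψ (maj G) : ℝ) ≤ (#(unfrozen F) + #(crowded r S₁)) +
      (#(crowded r S₂) + #(contested φ (unfrozen F)ᶜ (2 * r) S₃)) := by
    exact_mod_cast (card_le_card hsub).trans <| (card_union_le _ _).trans <|
      add_le_add (card_union_le _ _) (card_union_le _ _)
  linarith

end ThirdRound

section Rounds

variable {n : ℕ}

theorem sq_div_four_le_choose_two {m : ℕ} (hn : 300 ≤ n) (hm : 19 * n ≤ 20 * m + 20) :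
    (n : ℝ) ^ 2 / 4 ≤ m.choose 2 := by
  have hn' : (300 : ℝ) ≤ n := mod_cast hn
  have hm' : (19 : ℝ) * n ≤ 20 * m + 20 := mod_cast hm
  have hlarge : 3 / 4 * (n : ℝ) ≤ m - 1 := by linarith
  rw [Nat.cast_choose_two]
  nlinarith [hlarge]

theorem cube_div_le_choose_three (hn : 300 ≤ n) :
    (n : ℝ) ^ 3 / 10 ^ 5 ≤ (n / 20).choose 3 := by
  have hbase : (n : ℝ) / 25 ≤ (n / 20 + 1 - 3 : ℕ) := by
    rw [div_le_iff₀ (by norm_num)]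
    exact_mod_cast (by lia : n ≤ (n / 20 + 1 - 3) * 25)
  calc (n : ℝ) ^ 3 / 10 ^ 5 ≤ (n / 25) ^ 3 / Nat.factorial 3 := by
        norm_num [Nat.factorial, div_pow, div_div]
        gcongr
        norm_num
    _ ≤ ((n / 20 + 1 - 3 : ℕ) : ℝ) ^ 3 / Nat.factorial 3 := by gcongr
    _ ≤ (n / 20).choose 3 := Nat.pow_le_choose 3 (n / 20)

theorem choose_three_le_mul_choose_two {a m : ℕ} (h : a ≤ m) :
    a.choose 3 ≤ a * m.choose 2 := by
  have hsucc : a.choose 3 * 3 = a.choose 2 * (a - 2) := Nat.choose_succ_right_eq a 2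
  calc a.choose 3 ≤ a.choose 2 * (a - 2) := by lia
    _ ≤ m.choose 2 * a := Nat.mul_le_mul (Nat.choose_le_choose 2 h) (Nat.sub_le a 2)
    _ = a * m.choose 2 := mul_comm _ _

theorem two_mul_four_pow_mul_exp_le {y t : ℝ} (hn : 0 < n) (hy : 4000 ≤ y)
    (ht : n * y / 1000 ≤ t) : 2 * (4 ^ n * exp (-t)) ≤ 4000 / (n * y) := by
  have : (0 : ℝ) < n := mod_cast hn
  have hfour : (4 : ℝ) ≤ exp 2 := by
    linarith [quadratic_le_exp_of_nonneg (x := 2) (by norm_num)]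
  set z := n * y / 2000
  have : 0 < z := by positivity
  have hnz : 2 * n ≤ z := by
    rw [le_div_iff₀ (by norm_num)]
    nlinarith
  have hzt : 2 * z ≤ t := le_of_eq_of_le (by simp only [z]; ring) ht
  calc 2 * (4 ^ n * exp (-t)) ≤ 2 * (exp 2 ^ n * exp (-t)) := by gcongr
    _ = 2 * exp (n * 2 - t) := by rw [← exp_nat_mul, ← exp_add, sub_eq_add_neg]
    _ ≤ 2 * exp (-z) := by gcongr; linarith
    _ ≤ 2 * (1 / z) := by
        rw [exp_neg, ← one_div]
        gcongr
        linarith [add_one_le_exp z]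
    _ = 4000 / (n * y) := by simp only [z]; field_simp; norm_num

theorem measureReal_lt_card_crowded_le (q : unitInterval) {y r : ℝ} (hy : 3 ≤ y)
    (hr : 4 * y ≤ r / 4 - 7 / 2 * (n ^ 2 * q)) :
    (coinMeasure (Clause n) q).real {b | exp (-y) * n / 4 < #(crowded r (heads b))}
      ≤ 4 / (n * y) := by
  have h := measureReal_lt_card_le (coinMeasure (Clause n) q) (fun b ↦ crowded r (heads b)) hy
    fun X ↦ (measureReal_subset_crowded_le q r X).trans (by gcongr)
  rwa [Fintype.card_fin] at h

theorem measureReal_lt_card_contested_le (q : unitInterval) {y ρ : ℝ} (hy : 3 ≤ y)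
    (hρ : 4 * y ≤ 13 / 20000 * (n ^ 2 * q) - ρ / 200) (φ : Assignment n)
    {Z : Finset (Fin n)} (hZ : (n : ℝ) ^ 2 / 4 ≤ (#Z - 1).choose 2) :
    (coinMeasure (Clause n) q).real {b | exp (-y) * n / 4 < #(contested φ Z ρ (heads b))}
      ≤ 4 / (n * y) := by
  have h := measureReal_lt_card_le (coinMeasure (Clause n) q) (fun b ↦ contested φ Z ρ (heads b)) hy
    fun X ↦ (measureReal_subset_contested_le q φ hZ ρ X).trans (by gcongr)
  rwa [Fintype.card_fin] at h

theorem measureReal_lt_card_unfrozen_le (q : unitInterval) {y : ℝ} (hy : 3 ≤ y)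
    (hq : 4 * y ≤ n ^ 2 * q / 4) {F : Formula n} (hF : Satisfiable F)
    (hfrozen : (n : ℝ) ^ 2 / 4 ≤ (#(unfrozen F)ᶜ).choose 2)
    {ext : (Clause n → Bool) → Formula n} (hext : ∀ b, IsMaximalExtension F (heads b) (ext b)) :
    (coinMeasure (Clause n) q).real {b | exp (-y) * n / 4 < #(unfrozen (ext b))}
      ≤ 4 / (n * y) := by
  have hrate : 4 * y ≤ q * (#(unfrozen F)ᶜ).choose 2 := by
    nlinarith [mul_le_mul_of_nonneg_left hfrozen q.2.1]
  have h := measureReal_lt_card_le (coinMeasure (Clause n) q) (fun b ↦ unfrozen (ext b)) hy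
    fun X ↦ (measureReal_subset_unfrozen_le q hF hext X).trans <| by
      rw [Nat.cast_mul, mul_left_comm, mul_comm (#X : ℝ)]
      gcongr
  rwa [Fintype.card_fin] at h

theorem measureReal_div_twenty_le_card_unfrozen_le (hn : 300 ≤ n) (q : unitInterval) {y : ℝ}
    (hy : 4000 ≤ y) (hq : (n : ℝ) ^ 2 * q = 100 * y) {F : Formula n}
    {ext : (Clause n → Bool) → Formula n} (hext : ∀ b, IsMaximalExtension F (heads b) (ext b)) :
    (coinMeasure (Clause n) q).real {b | n / 20 ≤ #(unfrozen (ext b))} ≤ 4000 / (n * y) := by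
  refine (measureReal_card_unfrozen_ge_le q hext le_rfl
    (choose_three_le_mul_choose_two (by lia))).trans
    (two_mul_four_pow_mul_exp_le (by lia) hy ?_)
  calc n * y / 1000 = q * ((n : ℝ) ^ 3 / 10 ^ 5) := by linear_combination -(n / 10 ^ 5 : ℝ) * hq
    _ ≤ q * (n / 20).choose 3 :=
        mul_le_mul_of_nonneg_left (cube_div_le_choose_three hn) q.2.1

theorem measureReal_not_majClose_ext_le (q : unitInterval) {y : ℝ} (hy : 3 ≤ y)
    (hq : 5 * 10 ^ 5 * y ≤ n ^ 2 * q) {S₁ S₂ F : Formula n} (hF : Satisfiable F)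
    (hFS : F ⊆ S₁ ∪ S₂) (hfrozen : (n : ℝ) ^ 2 / 4 ≤ (#(unfrozen F)ᶜ - 1).choose 2)
    (hunfrozen : #(unfrozen F) ≤ exp (-y) * n / 4)
    (h₁ : #(crowded (10 ^ 4 * y) S₁) ≤ exp (-y) * n / 4)
    (h₂ : #(crowded (10 ^ 4 * y) S₂) ≤ exp (-y) * n / 4)
    {ext : (Clause n → Bool) → Formula n} (hext : ∀ b, IsMaximalExtension F (heads b) (ext b)) :
    (coinMeasure (Clause n) q).real {b | ¬ MajClose (ext b) (exp (-y) * n)} ≤ 4 / (n * y) := by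
  obtain ⟨φ, hφ⟩ := hF
  refine (measureReal_mono fun b hb ↦ ?_).trans
    (measureReal_lt_card_contested_le q (ρ := 2 * (10 ^ 4 * y)) hy (by linarith) φ hfrozen)
  exact not_le.1 fun hcontested ↦
    hb (majClose_of_card_le hFS (hext b) hφ hunfrozen h₁ h₂ hcontested)

variable {ext : Formula n → (Clause n → Bool) → Formula n}
  (hext : ∀ F, Satisfiable F → ∀ b, IsMaximalExtension F (heads b) (ext F b))
include hext

theorem measureReal_not_majClose_ext_ext_le (hn : 300 ≤ n) (q q₃ : unitInterval) {y : ℝ}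
    (hy : 3 ≤ y) (hq : (n : ℝ) ^ 2 * q = 100 * y) (hq₃ : 5 * 10 ^ 5 * y ≤ n ^ 2 * q₃)
    {S F : Formula n} (hF : Satisfiable F) (hFS : F ⊆ S) (hunfrozen : #(unfrozen F) < n / 20)
    (hS : #(crowded (10 ^ 4 * y) S) ≤ exp (-y) * n / 4) :
    ((coinMeasure (Clause n) q).prod (coinMeasure (Clause n) q₃)).real
        {ω | ¬ MajClose (ext (ext F ω.1) ω.2) (exp (-y) * n)}
      ≤ 4 / (n * y) + 4 / (n * y) + 4 / (n * y) := by
  have hfew := measureReal_lt_card_unfrozen_le q hy (by linarith) hF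
    (sq_div_four_le_choose_two hn (by rw [card_compl, Fintype.card_fin]; lia)) (hext F hF)
  have hcrowded := measureReal_lt_card_crowded_le (n := n) q (y := y) (r := 10 ^ 4 * y)
    hy (by linarith)
  have : 0 < y := by linarith
  refine (measureReal_prod_le_add _ _ (δ := 4 / (n * y))
    (A := {b | exp (-y) * n / 4 < #(unfrozen (ext F b))} ∪
      {b | exp (-y) * n / 4 < #(crowded (10 ^ 4 * y) (heads b))}) .of_discrete .of_discrete
    (by positivity) fun b hb ↦ ?_).trans
    (add_le_add_left ((measureReal_union_le _ _).trans (add_le_add hfew hcrowded)) _)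
  simp only [Set.mem_union, Set.mem_ofPred_eq, not_or, not_lt] at hb
  have hG := hext F hF b
  have hcard : #(unfrozen (ext F b)) ≤ #(unfrozen F) := card_le_card (unfrozen_anti hG.subset)
  exact measureReal_not_majClose_ext_le q₃ hy hq₃ hG.satisfiable
    (hG.subset_union.trans (union_subset_union_left hFS))
    (sq_div_four_le_choose_two hn (by rw [card_compl, Fintype.card_fin]; lia))
    hb.1 hS hb.2 (hext _ hG.satisfiable)

theorem measureReal_not_majClose_ext_ext_ext_le (hn : 300 ≤ n) (q q₃ : unitInterval) {y : ℝ}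
    (hy : 4000 ≤ y) (hq : (n : ℝ) ^ 2 * q = 100 * y) (hq₃ : 5 * 10 ^ 5 * y ≤ n ^ 2 * q₃) :
    (threeRounds (Clause n) q q q₃).real
        {ω | ¬ MajClose (ext (ext (ext ∅ ω.1) ω.2.1) ω.2.2) (exp (-y) * n)} ≤ 5000 / (n * y) := by
  have hfew := measureReal_div_twenty_le_card_unfrozen_le hn q hy hq
    (hext ∅ satisfiable_empty)
  have hcrowded := measureReal_lt_card_crowded_le (n := n) q (y := y) (r := 10 ^ 4 * y)
    (by linarith) (by linarith)
  calc _ ≤ (4000 / (n * y) + 4 / (n * y)) + (4 / (n * y) + 4 / (n * y) + 4 / (n * y)) := by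
        have : 0 < y := by linarith
        refine (measureReal_prod_le_add _ _ (δ := 4 / (n * y) + 4 / (n * y) + 4 / (n * y))
          (A := {b | n / 20 ≤ #(unfrozen (ext ∅ b))} ∪
            {b | exp (-y) * n / 4 < #(crowded (10 ^ 4 * y) (heads b))}) .of_discrete .of_discrete
          (by positivity) fun b hb ↦ ?_).trans
          (add_le_add_left ((measureReal_union_le _ _).trans (add_le_add hfew hcrowded)) _)
        simp only [Set.mem_union, Set.mem_ofPred_eq, not_or, not_lt, not_le] at hb
        have hG := hext ∅ satisfiable_empty b
        exact measureReal_not_majClose_ext_ext_le hext hn q q₃ (by linarith) hq hq₃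
          hG.satisfiable (hG.subset_union.trans (empty_union _).subset) hb.1 hb.2
    _ ≤ 5000 / (n * y) := by
        rw [← add_div, ← add_div, ← add_div, ← add_div]
        gcongr
        norm_num

end Rounds

theorem isMaximalExtension_scan_filter {n : ℕ} (σ : Ordering n) {F : Formula n}
    (hF : Satisfiable F) (b : Clause n → Bool) :
    IsMaximalExtension F (heads b) (scan F ((List.ofFn σ).filter b)) := by
  convert isMaximalExtension_scan hF ((List.ofFn σ).filter b)
  ext C
  simp [mem_heads, List.mem_ofFn, σ.surjective C]

theorem expectedTosses_le {n : ℕ} (p : unitInterval) :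
    expectedTosses n p ≤ 2 * ((n : ℝ) * ((n : ℝ) ^ 2 * p)) := by
  have hchoose := Nat.choose_le_pow_div (α := ℝ) 3 n
  norm_num [Nat.factorial] at hchoose
  rw [expectedTosses, Nat.cast_mul]
  have := mul_le_mul_of_nonneg_left hchoose p.2.1
  have : 0 ≤ (p : ℝ) * n ^ 3 := mul_nonneg p.2.1 (by positivity)
  push_cast
  linarith

theorem le_expectedTosses {n : ℕ} (hn : 4 ≤ n) (p : unitInterval) :
    (n : ℝ) * ((n : ℝ) ^ 2 * p) / 6 ≤ expectedTosses n p := by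
  have hbase : (n : ℝ) / 2 ≤ (n + 1 - 3 : ℕ) := by
    rw [div_le_iff₀ (by norm_num)]
    exact_mod_cast (by lia : n ≤ (n + 1 - 3) * 2)
  have hchoose : (n : ℝ) ^ 3 / 6 ≤ 8 * n.choose 3 := by
    calc (n : ℝ) ^ 3 / 6 = 8 * ((n / 2) ^ 3 / Nat.factorial 3) := by
          norm_num [Nat.factorial]
          ring
      _ ≤ 8 * (((n + 1 - 3 : ℕ) : ℝ) ^ 3 / Nat.factorial 3) := by gcongr
      _ ≤ 8 * n.choose 3 := by gcongr; exact Nat.pow_le_choose 3 n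
  rw [expectedTosses, Nat.cast_mul]
  have := mul_le_mul_of_nonneg_left hchoose p.2.1
  push_cast
  linarith

theorem toReal_psat_not_majClose_le {n : ℕ} (hn : 300 ≤ n) (p : unitInterval)
    (hp : 4 * 10 ^ 9 ≤ (n : ℝ) ^ 2 * p) :
    ((Psat n p).toOuterMeasure
        {F | ¬ MajClose F (exp (-(1 / 10 ^ 6 * ((n : ℝ) ^ 2 * p))) * n)}).toReal
      ≤ 10 ^ 10 / expectedTosses n p := by
  set y : ℝ := 1 / 10 ^ 6 * ((n : ℝ) ^ 2 * p) with hy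
  -- The factor `10 ^ 4` is such that the at most `2 * 10 ^ 4 * y` clauses that the first two rounds
  -- contribute at an uncrowded variable do not outweigh the drift of the third.
  let q : unitInterval := ⟨p / 10 ^ 4, div_nonneg p.2.1 (by norm_num),
    div_le_one_of_le₀ (p.2.2.trans (by norm_num)) (by norm_num)⟩
  have hq : (n : ℝ) ^ 2 * q = 100 * y := by simp only [q, hy]; ring
  obtain ⟨q₃, hcoins, hq₃⟩ := exists_coinOr_coinOr_eq (p := p) (q := q)
    (div_le_div_of_nonneg_left p.2.1 (by norm_num) (by norm_num))
  have hnq₃ : 5 * 10 ^ 5 * y ≤ n ^ 2 * q₃ := by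
    nlinarith [mul_le_mul_of_nonneg_left hq₃ (sq_nonneg (n : ℝ))]
  have hfail := toReal_psat_le q q q₃ n (fun F ↦ ¬ MajClose F (exp (-y) * n)) fun σ ↦
    measureReal_not_majClose_ext_ext_ext_le (fun F hF ↦ isMaximalExtension_scan_filter σ hF)
      hn q q₃ (y := y) (by linarith) hq hnq₃
  rw [hcoins] at hfail
  refine hfail.trans ?_
  have : 0 < y := by linarith
  have hm : 0 < expectedTosses n p := by
    refine lt_of_lt_of_le ?_ (le_expectedTosses (by lia) p)
    positivity
  rw [div_le_div_iff₀ (by positivity) hm]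
  nlinarith [expectedTosses_le (n := n) p]

theorem tendsto_expectedTosses_atTop {p : ℕ → unitInterval} {d : ℝ} (hd : 0 < d)
    (hp : ∀ᶠ n : ℕ in Filter.atTop, d ≤ (n : ℝ) ^ 2 * p n) :
    Filter.Tendsto (fun n ↦ expectedTosses n (p n)) Filter.atTop Filter.atTop := by
  refine Filter.tendsto_atTop_mono' _ ?_
    (tendsto_natCast_atTop_atTop.atTop_mul_const (r := d / 6) (by positivity))
  filter_upwards [hp, Filter.eventually_ge_atTop 4] with n hpn hn
  calc (n : ℝ) * (d / 6) ≤ n * ((n : ℝ) ^ 2 * p n / 6) := by gcongr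
    _ = (n : ℝ) * ((n : ℝ) ^ 2 * p n) / 6 := (mul_div_assoc _ _ _).symm
    _ ≤ expectedTosses n (p n) := le_expectedTosses hn (p n)

theorem whp_of_eventually_le_div_expectedTosses {p : ℕ → unitInterval}
    {A : (n : ℕ) → Formula n → Prop} {K : ℝ}
    (hm : Filter.Tendsto (fun n ↦ expectedTosses n (p n)) Filter.atTop Filter.atTop)
    (hA : ∀ᶠ n in Filter.atTop, ((Psat n (p n)).toOuterMeasure {F | ¬ A n F}).toReal
      ≤ K / expectedTosses n (p n)) : Whp p A := by
  have hbigO : (fun n ↦ ((Psat n (p n)).toOuterMeasure {F | ¬ A n F}).toReal)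
      =O[Filter.atTop] fun n ↦ (expectedTosses n (p n))⁻¹ := by
    refine .of_bound K ?_
    filter_upwards [hA, hm.eventually_gt_atTop 0] with n hAn hmn
    rwa [norm_of_nonneg ENNReal.toReal_nonneg, norm_of_nonneg (inv_pos.2 hmn).le, ← div_eq_mul_inv]
  have hsqrt : (fun x : ℝ ↦ √x) =o[Filter.atTop] fun x ↦ x := by
    refine Asymptotics.isLittleO_of_tendsto (fun x hx ↦ by rw [hx, sqrt_zero]) ?_
    simpa only [sqrt_div_self'] using tendsto_sqrt_atTop.const_div_atTop (1 : ℝ)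
  refine hbigO.trans_isLittleO ((hsqrt.comp_tendsto hm).inv_rev ?_)
  filter_upwards [hm.eventually_gt_atTop 0] with n hmn hzero
  exact absurd hzero (sqrt_pos.2 hmn).ne'

end RandomSat

theorem mainTheorem4 :
    ∃ c : ℝ, 0 < c ∧ ∃ d : ℝ, 0 < d ∧
      ∀ p : ℕ → unitInterval,
        (∀ᶠ n : ℕ in Filter.atTop, d ≤ (n : ℝ) ^ 2 * (p n : ℝ)) →
        RandomSat.Whp p fun n F =>
          RandomSat.MajClose F (Real.exp (-(c * ((n : ℝ) ^ 2 * (p n : ℝ)))) * (n : ℝ)) := by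
  refine ⟨1 / 10 ^ 6, by norm_num, 4 * 10 ^ 9, by norm_num, fun p hp ↦ ?_⟩
  refine RandomSat.whp_of_eventually_le_div_expectedTosses
    (RandomSat.tendsto_expectedTosses_atTop (by norm_num) hp) (K := 10 ^ 10) ?_
  filter_upwards [hp, Filter.eventually_ge_atTop 300] with n hpn hn
  exact RandomSat.toReal_psat_not_majClose_le hn (p n) hpn
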